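/- **Setting.** A *cubic graph* is a finite multigraph $G$ (loops and multiple edges allowed) in which exactly three edge ends meet at every vertex, a loop counting twice. A *proper 3-edge-coloring* assigns one of the colors $r,b,p$ to every edge so that all three colors occur at every vertex. An *immersion* of $G$ in the plane places the vertices at distinct points and draws every edge as a $C^1$ curve on $[0,1]$ with nowhere vanishing velocity that joins its end vertices, such that the edge ends at a vertex leave it in pairwise distinct directions, the interiors of edges avoid the vertices, and the interiors of edges meet themselves and each other only in finitely many transverse double points (the *crossings*). A *diagram* consists of finitely many arcs, of nodes with three arc ends in clockwise cyclic order, and of crossings, at each of which two strands meet, each strand being formed by two arc ends. Every crossing is of one of three kinds: circled, plain or dotted. Closed curves without nodes and crossings are allowed as arcs. The *bracket* $[D]\in\mathbb C$ of a diagram is the tensor contraction: the sum, over all assignments of the colors $r,b,p$ to the arcs, of the product of the following values. * A node whose arcs have colors $i,j,k$ in clockwise order contributes $\sqrt{-1}\,\epsilon_{ijk}$, where $\epsilon_{rbp}=\epsilon_{bpr}=\epsilon_{prb}=1$, $\epsilon_{rpb}=\epsilon_{pbr}=\epsilon_{brp}=-1$ and $\epsilon_{ijk}=0$ otherwise. *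 A circled crossing contributes $0$ unless the two arc ends of each strand have the same color; if the strands have colors $x$ and $y$, it contributes $+1$ if $x=y$ and $-1$ if $x\ne y$. * A plain crossing contributes $1$ if the two arc ends of each strand have the same color, and $0$ otherwise. * A dotted crossing contributes $1$ if all four arc ends have the same color, and $0$ otherwise. **Theorem (Extending the Penrose bracket to all cubic graphs).** Let $G$ be a cubic graph with an immersion in the plane. Let $[G]$ be the bracket of the diagram obtained by cutting $G$ into arcs at its vertices and crossings and circling all the crossings. Then $[G]$ equals the number of proper 3-edge-colorings of $G$. Moreover, the bracket of all diagrams satisfies the following relations. 1. (*Penrose relation*) Let two distinct nodes $u,v$ of a diagram $D$ be joined by an arc $e$ without crossings. Draw $e$ vertically with $u$ above $v$, so that the other arc ends at $u$ and $v$ are, in clockwise order, $1$ (upper left), $2$ (upper right), $3$ (lower right), $4$ (lower left). Then $[D]=[D_{\parallel}]-[D_{\times}]$, where $D_{\parallel}$ is obtained from $D$ by replacing $u,v,e$ with two parallel strands joining $1$ to $4$ and $2$ to $3$, and $D_{\times}$ by replacing them with a plain crossing of a strand joining $1$ to $3$ and a strand joining $2$ to $4$. 2. $[O\,D]=3[D]$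 and $[O]=3$, where $O$ is a single closed curve without nodes and crossings and $O\,D$ is the disjoint union. 3. If $x$ is a circled crossing of $D$, then $[D]=2[D_{\mathrm{dot}}]-[D_{\mathrm{plain}}]$, where $D_{\mathrm{dot}}$ and $D_{\mathrm{plain}}$ are obtained from $D$ by making $x$ dotted and plain, respectively. -/

import Mathlib

open scoped Graph ComplexConjugate

/-! ### Colours and tensors -/

/-- The three colours red, blue, purple. -/
inductive Color
  | r
  | b
  | p
  deriving DecidableEq

instance : Fintype Color where
  elems := {.r, .b, .p}
  complete c := by cases c <;> decide

/-- The epsilon tensor on the colours, with `(r b p)` even. -/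
def epsilonTensor : Color → Color → Color → ℂ
  | .r, .b, .p => 1
  | .b, .p, .r => 1
  | .p, .r, .b => 1
  | .r, .p, .b => -1
  | .p, .b, .r => -1
  | .b, .r, .p => -1
  | _, _, _ => 0

/-- The tensor `√-1 ε` placed at a node; its indices are read clockwise around the node. -/
noncomputable def nodeTensor (i j k : Color) : ℂ := Complex.I * epsilonTensor i j k

/-- The three kinds of four-valent crossing sites of a diagram. -/
inductive CrossingKind
  | circled
  | plain
  | dotted

/-- The tensor of a crossing at which one strand has end colours `x`, `x'` and the other strand has
end colours `y`, `y'`. -/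
def crossingTensor : CrossingKind → Color → Color → Color → Color → ℂ
  | .circled, x, x', y, y' => if x = x' ∧ y = y' then (if x = y then 1 else -1) else 0
  | .plain, x, x', y, y' => if x = x' ∧ y = y' then 1 else 0
  | .dotted, x, x', y, y' => if x = x' ∧ x = y ∧ x = y' then 1 else 0

/-! ### Diagrams and their brackets -/

/-- A piece of a diagram with `k` free boundary ends. Its arcs `A` are the strands obtained by
cutting the diagram at its nodes `N` and its crossings `X`.
In a drawing every arc has two ends (counting slots at nodes, at crossings and on the boundary), or
no end at all if it is a closed curve without crossings. This is not imposed: the contraction makes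
sense without it. -/
structure Tangle (k : ℕ) (A N X : Type*) where
  /-- the three arcs at a node, in clockwise order -/
  leg : N → Fin 3 → A
  /-- the kind of each crossing -/
  kind : X → CrossingKind
  /-- `strand x s` lists the two arcs that make up the strand `s` passing through `x` -/
  strand : X → Fin 2 → Fin 2 → A
  /-- the arcs at the boundary ends, in clockwise order -/
  bd : Fin k → A

/-- A closed diagram. -/
abbrev Diagram (A N X : Type*) := Tangle 0 A N X

namespace Tangle

variable {k : ℕ} {A N X A' N' X' : Type*}

/-- The bracket `[D]`: the full contraction of the tensors at the nodes and crossings, that is, the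
sum over all colourings of the arcs of the product of the tensor values. -/
noncomputable def bracket (D : Diagram A N X) : ℂ :=
  ∑ᶠ c : A → Color,
    (∏ᶠ n : N, nodeTensor (c (D.leg n 0)) (c (D.leg n 1)) (c (D.leg n 2))) *
    ∏ᶠ x : X, crossingTensor (D.kind x) (c (D.strand x 0 0)) (c (D.strand x 0 1))
      (c (D.strand x 1 0)) (c (D.strand x 1 1))

/-- The diagram `D` with the crossing `x` changed to the kind `κ`. -/
noncomputable def withKind (D : Tangle k A N X) (x : X) (κ : CrossingKind) : Tangle k A N X :=
  open Classical in { D with kind := Function.update D.kind x κ }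

/-- The relation joining corresponding boundary ends of two tangles. -/
inductive GlueRel (T : Tangle k A N X) (P : Tangle k A' N' X') : A ⊕ A' → A ⊕ A' → Prop
  | mk (i : Fin k) : GlueRel T P (Sum.inl (T.bd i)) (Sum.inr (P.bd i))

/-- The closed diagram obtained by joining the `i`-th end of `T` to the `i`-th end of `P` for every
`i`; for `k = 0` this is the disjoint union. -/
def glue (T : Tangle k A N X) (P : Tangle k A' N' X') :
    Diagram (Quot (GlueRel T P)) (N ⊕ N') (X ⊕ X') where
  leg n l := Quot.mk _ (Sum.elim (fun n => Sum.inl (T.leg n l)) (fun n => Sum.inr (P.leg n l)) n)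
  kind := Sum.elim T.kind P.kind
  strand x s j := Quot.mk _
    (Sum.elim (fun x => Sum.inl (T.strand x s j)) (fun x => Sum.inr (P.strand x s j)) x)
  bd i := i.elim0

/-- A single circle `O` without nodes and crossings. -/
def circle : Diagram Unit Empty Empty where
  leg n := n.elim
  kind x := x.elim
  strand x := x.elim
  bd i := i.elim0

/-- Two parallel strands, joining the ends `0`, `3` and the ends `1`, `2` (of the ends `0, 1, 2, 3`
in clockwise order). -/
def parallel : Tangle 4 (Fin 2) Empty Empty where
  leg n := n.elim
  kind x := x.elim
  strand x := x.elim
  bd := ![0, 1, 1, 0]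

/-- One plain crossing of a strand joining the ends `0`, `2` with a strand joining the ends
`1`, `3`. -/
def crossed : Tangle 4 (Fin 4) Empty Unit where
  leg n := n.elim
  kind _ := .plain
  strand _ := ![![0, 2], ![1, 3]]
  bd := ![0, 1, 2, 3]

/-- A Y-form in a diagram: two distinct nodes `u`, `v` joined by an arc `edge` without crossings,
which occupies the slot `i` of `u` and the slot `j` of `v`. -/
structure YForm (D : Diagram A N X) where
  u : N
  v : N
  u_ne_v : u ≠ v
  edge : A
  i : Fin 3
  j : Fin 3
  leg_u : D.leg u i = edge
  leg_v : D.leg v j = edge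
  leg_eq_edge : ∀ n l, D.leg n l = edge → (n = u ∧ l = i) ∨ (n = v ∧ l = j)
  strand_ne_edge : ∀ x s t, D.strand x s t ≠ edge

/-- What remains of the diagram after removing a Y-form. With `edge` drawn vertically, `u` above
`v`, the four ends `0, 1, 2, 3` are the upper left, upper right, lower right and lower left one. -/
def YForm.outside {D : Diagram A N X} (Y : YForm D) :
    Tangle 4 {a : A // a ≠ Y.edge} {n : N // n ≠ Y.u ∧ n ≠ Y.v} X where
  leg n l := ⟨D.leg n l, fun h => (Y.leg_eq_edge _ _ h).elim (fun h' => n.2.1 h'.1)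
    (fun h' => n.2.2 h'.1)⟩
  kind := D.kind
  strand x s t := ⟨D.strand x s t, Y.strand_ne_edge x s t⟩
  bd :=
    have hu : ∀ l, l ≠ Y.i → D.leg Y.u l ≠ Y.edge := fun l hl h =>
      (Y.leg_eq_edge _ _ h).elim (fun h' => hl h'.2) (fun h' => Y.u_ne_v h'.1)
    have hv : ∀ l, l ≠ Y.j → D.leg Y.v l ≠ Y.edge := fun l hl h =>
      (Y.leg_eq_edge _ _ h).elim (fun h' => Y.u_ne_v h'.1.symm) (fun h' => hl h'.2)
    ![⟨D.leg Y.u (Y.i + 1), hu _ (by simp)⟩,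
      ⟨D.leg Y.u (Y.i + 2), hu _ (by simp)⟩,
      ⟨D.leg Y.v (Y.j + 1), hv _ (by simp)⟩,
      ⟨D.leg Y.v (Y.j + 2), hv _ (by simp)⟩]

end Tangle

/-! ### Cubic graphs and proper colourings -/

section CubicGraph

variable {α β : Type*}

/-- A multigraph is cubic if exactly three edge ends meet at every vertex, a loop being counted
twice: there are three edges, none of them a loop, or two edges, exactly one of them a loop. -/
def IsCubicGraph (G : Graph α β) : Prop :=
  ∀ v ∈ V(G), (G.incidenceSet v).encard + (G.loopSet v).encard = 3

/-- A proper three-edge-colouring of a cubic graph: all three colours occur at every vertex. -/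
def IsProperEdgeColoring (G : Graph α β) (c : E(G) → Color) : Prop :=
  ∀ v ∈ V(G), ∀ κ : Color, ∃ e : E(G), G.Inc e v ∧ c e = κ

/-! ### Immersions of graphs in the plane -/

/-- A placement of the vertices of `G` in the plane `ℂ`, with a curve, parametrized by `[0,1]`, for
every edge. -/
structure PlaneDrawing (G : Graph α β) where
  pos : V(G) → ℂ
  curve : E(G) → ℝ → ℂ

namespace PlaneDrawing

variable {G : Graph α β} (Γ : PlaneDrawing G)

/-- The velocity of an edge, one-sided at the end points of `[0,1]`. -/
noncomputable def velocity (e : E(G)) (t : ℝ) : ℂ :=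
  derivWithin (Γ.curve e) (Set.Icc 0 1) t

/-- The base point of an edge end; `(e, false)` is the end of `e` at `0`, `(e, true)` the one at
`1`. -/
def base (h : E(G) × Bool) : ℂ := Γ.curve h.1 (if h.2 then 1 else 0)

/-- The tangent vector of an edge end, pointing away from its base point. -/
noncomputable def out (h : E(G) × Bool) : ℂ :=
  if h.2 then -Γ.velocity h.1 1 else Γ.velocity h.1 0

/-- The parameters at which the edge `e` passes through a crossing. -/
def cutTimes (e : E(G)) : Set ℝ :=
  {t | t ∈ Set.Ioo 0 1 ∧ ∃ x : E(G) × Set.Ioo (0 : ℝ) 1,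
    (x.1, (x.2 : ℝ)) ≠ (e, t) ∧ Γ.curve x.1 x.2 = Γ.curve e t}

/-- Immersions of a graph in the plane whose only multiple points are finitely many transverse
double points in the interiors of edges. -/
structure IsImmersion : Prop where
  pos_injective : Function.Injective Γ.pos
  ends : ∀ e : E(G), ∃ x y : V(G),
    G.IsLink e x y ∧ Γ.curve e 0 = Γ.pos x ∧ Γ.curve e 1 = Γ.pos y
  contDiffOn : ∀ e, ContDiffOn ℝ 1 (Γ.curve e) (Set.Icc 0 1)
  velocity_ne_zero : ∀ e, ∀ t ∈ Set.Icc (0 : ℝ) 1, Γ.velocity e t ≠ 0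
  /-- the edge ends at a vertex leave it in distinct directions -/
  not_sameRay : ∀ h h' : E(G) × Bool, h ≠ h' → Γ.base h = Γ.base h' →
    ¬ SameRay ℝ (Γ.out h) (Γ.out h')
  /-- the interiors of edges avoid the vertices -/
  curve_ne_pos : ∀ e, ∀ t ∈ Set.Ioo (0 : ℝ) 1, ∀ v, Γ.curve e t ≠ Γ.pos v
  transverse : ∀ e e', ∀ t ∈ Set.Ioo (0 : ℝ) 1, ∀ t' ∈ Set.Ioo (0 : ℝ) 1,
    (e, t) ≠ (e', t') → Γ.curve e t = Γ.curve e' t' →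
    LinearIndependent ℝ ![Γ.velocity e t, Γ.velocity e' t']
  no_triple_point : ∀ x y z : E(G) × Set.Ioo (0 : ℝ) 1,
    Γ.curve x.1 x.2 = Γ.curve y.1 y.2 → Γ.curve y.1 y.2 = Γ.curve z.1 z.2 →
    x = y ∨ y = z ∨ x = z
  finite_cutTimes : ∀ e, (Γ.cutTimes e).Finite

end PlaneDrawing

/-- Three nonzero vectors in the plane `ℂ` with distinct directions occur in this clockwise order
around the origin: the corresponding points of the unit circle span a triangle of negative signed
area. -/
def Clockwise (a b c : ℂ) : Prop :=
  (conj (b / ‖b‖ - a / ‖a‖) * (c / ‖c‖ - a / ‖a‖)).im < 0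

theorem Clockwise.or_swap {a b c : ℂ} (ha : a ≠ 0) (hb : b ≠ 0) (hc : c ≠ 0)
    (hab : ¬ SameRay ℝ a b) (hac : ¬ SameRay ℝ a c) (hbc : ¬ SameRay ℝ b c) :
    Clockwise a b c ∨ Clockwise a c b := by
  have unit : ∀ z : ℂ, z ≠ 0 → (z / ‖z‖).re ^ 2 + (z / ‖z‖).im ^ 2 = 1 := by
    intro z hz
    have h : Complex.normSq (z / ‖z‖) = 1 := by
      rw [Complex.normSq_eq_norm_sq, norm_div, Complex.norm_real, norm_norm,
        div_self (norm_ne_zero_iff.2 hz), one_pow]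
    rw [Complex.normSq_apply] at h
    nlinarith
  have ne : ∀ z w : ℂ, z ≠ 0 → w ≠ 0 → ¬ SameRay ℝ z w → z / ‖z‖ ≠ w / ‖w‖ := by
    intro z w hz hw h h'
    refine h ((sameRay_iff_inv_norm_smul_eq_of_ne hz hw).2 ?_)
    rw [Complex.real_smul, Complex.real_smul, Complex.ofReal_inv, Complex.ofReal_inv,
      inv_mul_eq_div, inv_mul_eq_div, h']
  have h1 := unit a ha
  have h2 := unit b hb
  have h3 := unit c hc
  have n1 := ne a b ha hb hab
  have n2 := ne a c ha hc hac
  have n3 := ne b c hb hc hbc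
  unfold Clockwise
  generalize a / ‖a‖ = u at *
  generalize b / ‖b‖ = v at *
  generalize c / ‖c‖ = w at *
  simp only [map_sub, Complex.mul_im, Complex.sub_re, Complex.sub_im, Complex.conj_re,
    Complex.conj_im]
  by_contra! hcon
  obtain ⟨k1, k2⟩ := hcon
  have hz : (v.re - u.re) * (w.im - u.im) - (v.im - u.im) * (w.re - u.re) = 0 := by
    linarith
  have sq : ∀ z z' : ℂ, z ≠ z' → 0 < (z.re - z'.re) ^ 2 + (z.im - z'.im) ^ 2 := by
    intro z z' h
    by_contra! hc
    refine h (Complex.ext ?_ ?_) <;> nlinarith [sq_nonneg (z.re - z'.re), sq_nonneg (z.im - z'.im)]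
  have p1 := sq u v n1
  have p2 := sq u w n2
  have p3 := sq v w n3
  have key : ((u.re - v.re) ^ 2 + (u.im - v.im) ^ 2) * ((u.re - w.re) ^ 2 + (u.im - w.im) ^ 2) *
      ((v.re - w.re) ^ 2 + (v.im - w.im) ^ 2) =
      4 * ((v.re - u.re) * (w.im - u.im) - (v.im - u.im) * (w.re - u.re)) ^ 2 := by
    obtain ⟨P, hP⟩ : ∃ P, P = u.re * v.re + u.im * v.im := ⟨_, rfl⟩
    obtain ⟨Q, hQ⟩ : ∃ Q, Q = u.re * w.re + u.im * w.im := ⟨_, rfl⟩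
    obtain ⟨R, hR⟩ : ∃ R, R = v.re * w.re + v.im * w.im := ⟨_, rfl⟩
    have gram : 1 + 2 * P * Q * R - P ^ 2 - Q ^ 2 - R ^ 2 = 0 := by
      have : (u.re ^ 2 + u.im ^ 2) * (v.re ^ 2 + v.im ^ 2) * (w.re ^ 2 + w.im ^ 2) +
          2 * P * Q * R - (w.re ^ 2 + w.im ^ 2) * P ^ 2 - (v.re ^ 2 + v.im ^ 2) * Q ^ 2 -
          (u.re ^ 2 + u.im ^ 2) * R ^ 2 = 0 := by
        rw [hP, hQ, hR]; ring
      rw [h1, h2, h3] at this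
      linarith
    have e1 : (u.re - v.re) ^ 2 + (u.im - v.im) ^ 2 = 2 - 2 * P := by
      rw [hP]; linear_combination h1 + h2
    have e2 : (u.re - w.re) ^ 2 + (u.im - w.im) ^ 2 = 2 - 2 * Q := by
      rw [hQ]; linear_combination h1 + h3
    have e3 : (v.re - w.re) ^ 2 + (v.im - w.im) ^ 2 = 2 - 2 * R := by
      rw [hR]; linear_combination h2 + h3
    have e4 : ((v.re - u.re) * (w.im - u.im) - (v.im - u.im) * (w.re - u.re)) ^ 2 =
        (2 - 2 * P) * (2 - 2 * Q) - (1 + R - P - Q) ^ 2 := by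
      have e5 : (v.re - u.re) * (w.re - u.re) + (v.im - u.im) * (w.im - u.im) = 1 + R - P - Q := by
        rw [hP, hQ, hR]; linear_combination h1
      rw [← e1, ← e2, ← e5]; ring
    rw [e1, e2, e3, e4]
    linear_combination (-4) * gram
  rw [hz] at key
  have := mul_pos (mul_pos p1 p2) p3
  linarith

namespace PlaneDrawing

variable {G : Graph α β} {Γ : PlaneDrawing G}

theorem IsImmersion.exists_legs (hΓ : Γ.IsImmersion) (hG : IsCubicGraph G) (v : V(G)) :
    ∃ f : Fin 3 → E(G) × Bool, {h | Γ.base h = Γ.pos v} = Set.range f ∧ Function.Injective f ∧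
      Clockwise (Γ.out (f 0)) (Γ.out (f 1)) (Γ.out (f 2)) := by
  have out_ne : ∀ h, Γ.out h ≠ 0 := by
    rintro ⟨e, b⟩
    cases b
    · simpa [out] using hΓ.velocity_ne_zero e 0 (by simp)
    · simpa [out] using hΓ.velocity_ne_zero e 1 (by simp)
  let A : Bool → Set E(G) := fun b => {e | Γ.base (e, b) = Γ.pos v}
  have hmem : ∀ e : E(G), ∃ x y : V(G), G.IsLink e x y ∧
      (e ∈ A false ↔ v = x) ∧ (e ∈ A true ↔ v = y) := by
    intro e
    obtain ⟨x, y, hl, hx, hy⟩ := hΓ.ends e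
    refine ⟨x, y, hl, ?_, ?_⟩
    · simp [A, base, hx, hΓ.pos_injective.eq_iff, eq_comm]
    · simp [A, base, hy, hΓ.pos_injective.eq_iff, eq_comm]
  have hinc : G.incidenceSet v = Subtype.val '' (A false ∪ A true) := by
    ext e
    constructor
    · intro he
      have he' : G.Inc e v := he
      obtain ⟨x, y, hl, h0, h1⟩ := hmem ⟨e, he'.edge_mem⟩
      refine ⟨⟨e, he'.edge_mem⟩, ?_, rfl⟩
      rcases he'.eq_or_eq_of_isLink hl with h | h
      · exact Or.inl (h0.2 (Subtype.ext h))
      · exact Or.inr (h1.2 (Subtype.ext h))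
    · rintro ⟨e, he, rfl⟩
      obtain ⟨x, y, hl, h0, h1⟩ := hmem e
      rcases he with he | he
      · rw [h0.1 he]; exact hl.inc_left
      · rw [h1.1 he]; exact hl.inc_right
  have hloop : G.loopSet v = Subtype.val '' (A false ∩ A true) := by
    ext e
    constructor
    · intro he
      have he' : G.IsLoopAt e v := he
      obtain ⟨x, y, hl, h0, h1⟩ := hmem ⟨e, he'.edge_mem⟩
      refine ⟨⟨e, he'.edge_mem⟩, ⟨h0.2 ?_, h1.2 ?_⟩, rfl⟩
      · exact Subtype.ext (he'.eq_of_inc hl.inc_left)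
      · exact Subtype.ext (he'.eq_of_inc hl.inc_right)
    · rintro ⟨e, he, rfl⟩
      obtain ⟨x, y, hl, h0, h1⟩ := hmem e
      have hx := h0.1 he.1
      have hy := h1.1 he.2
      subst hx
      subst hy
      exact hl
  have hS : {h : E(G) × Bool | Γ.base h = Γ.pos v} =
      (fun e => (e, false)) '' A false ∪ (fun e => (e, true)) '' A true := by
    ext ⟨e, b⟩
    cases b <;> simp [A]
  have hcard : {h : E(G) × Bool | Γ.base h = Γ.pos v}.encard = 3 := by
    have hd : Disjoint ((fun e : E(G) => (e, false)) '' A false)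
        ((fun e : E(G) => (e, true)) '' A true) := by
      rw [Set.disjoint_left]
      rintro _ ⟨e, _, rfl⟩ ⟨e', _, h⟩
      simp at h
    rw [hS, Set.encard_union_eq hd,
      Function.Injective.encard_image (fun _ _ h => (Prod.ext_iff.1 h).1),
      Function.Injective.encard_image (fun _ _ h => (Prod.ext_iff.1 h).1),
      ← Set.encard_union_add_encard_inter, ← hG v v.2, hinc, hloop,
      Subtype.val_injective.encard_image, Subtype.val_injective.encard_image]
  obtain ⟨x, y, z, hxy, hxz, hyz, hset⟩ := Set.encard_eq_three.1 hcard
  have hb : ∀ h, h = x ∨ h = y ∨ h = z → Γ.base h = Γ.pos v := by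
    intro h hh
    have : h ∈ ({x, y, z} : Set (E(G) × Bool)) := by simpa using hh
    rw [← hset] at this
    exact this
  have hx := hb x (by simp)
  have hy := hb y (by simp)
  have hz := hb z (by simp)
  rcases Clockwise.or_swap (out_ne x) (out_ne y) (out_ne z)
    (hΓ.not_sameRay _ _ hxy (hx.trans hy.symm)) (hΓ.not_sameRay _ _ hxz (hx.trans hz.symm))
    (hΓ.not_sameRay _ _ hyz (hy.trans hz.symm)) with h | h
  · refine ⟨![x, y, z], ?_, ?_, h⟩
    · rw [hset]; ext; simp [eq_comm]; tauto
    · intro i j; fin_cases i <;> fin_cases j <;> simp [hxy, hxz, hyz, hxy.symm, hxz.symm, hyz.symm]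
  · refine ⟨![x, z, y], ?_, ?_, h⟩
    · rw [hset]; ext; simp [eq_comm, or_comm, or_left_comm]
    · intro i j; fin_cases i <;> fin_cases j <;> simp [hxy, hxz, hyz, hxy.symm, hxz.symm, hyz.symm]

/-- The three edge ends at a vertex, listed in clockwise order (the listing is determined up to
cyclic permutation, which does not affect the epsilon tensor). -/
noncomputable def IsImmersion.legs (hΓ : Γ.IsImmersion) (hG : IsCubicGraph G) (v : V(G)) :
    Fin 3 → E(G) × Bool :=
  (hΓ.exists_legs hG v).choose

variable (Γ) in
/-- The crossings of an immersed graph: the points of the plane at which two different points of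
edge interiors meet. -/
abbrev Crossing : Type :=
  {p : ℂ // ∃ x y : E(G) × Set.Ioo (0 : ℝ) 1,
    x ≠ y ∧ Γ.curve x.1 x.2 = p ∧ Γ.curve y.1 y.2 = p}

/-- The two points of edge interiors that meet at a crossing. -/
noncomputable def Crossing.strandPoint (p : Γ.Crossing) : Fin 2 → E(G) × Set.Ioo (0 : ℝ) 1 :=
  ![p.2.choose, p.2.choose_spec.choose]

variable (Γ) in
/-- The arcs of an immersed graph: an edge with `m` crossing parameters is cut into `m + 1` arcs,
numbered `0, …, m` along the edge. -/
abbrev Arc : Type _ := Σ e : E(G), Fin ((Γ.cutTimes e).ncard + 1)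

/-- The arc of `e` that ends at the parameter `t`. -/
noncomputable def IsImmersion.arcBefore (hΓ : Γ.IsImmersion) (e : E(G)) (t : ℝ) : Γ.Arc :=
  ⟨e, (Γ.cutTimes e ∩ Set.Iio t).ncard, Nat.lt_succ_of_le
    (Set.ncard_le_ncard Set.inter_subset_left (hΓ.finite_cutTimes e))⟩

/-- The arc of `e` that starts at the parameter `t`. -/
noncomputable def IsImmersion.arcAfter (hΓ : Γ.IsImmersion) (e : E(G)) (t : ℝ) : Γ.Arc :=
  ⟨e, (Γ.cutTimes e ∩ Set.Iic t).ncard, Nat.lt_succ_of_le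
    (Set.ncard_le_ncard Set.inter_subset_left (hΓ.finite_cutTimes e))⟩

/-- The arc at an edge end. -/
noncomputable def IsImmersion.endArc (hΓ : Γ.IsImmersion) (h : E(G) × Bool) : Γ.Arc :=
  if h.2 then hΓ.arcBefore h.1 1 else hΓ.arcAfter h.1 0

/-- The diagram of an immersed cubic graph: it is cut into arcs at its vertices and crossings, and
all its crossings are circled. -/
noncomputable def IsImmersion.diagram (hΓ : Γ.IsImmersion) (hG : IsCubicGraph G) :
    Diagram Γ.Arc V(G) Γ.Crossing where
  leg v l := hΓ.endArc (hΓ.legs hG v l)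
  kind _ := .circled
  strand p s := ![hΓ.arcBefore (p.strandPoint s).1 (p.strandPoint s).2,
    hΓ.arcAfter (p.strandPoint s).1 (p.strandPoint s).2]
  bd i := i.elim0

end PlaneDrawing

end CubicGraph

/-! A circled crossing forces the colour to continue along each strand, and a node forces three
distinct colours, so the bracket is a sum over proper colourings `c`. The weight of `c` is the
product of the node tensors, each `√-1` or `-√-1`, times `-1` for every crossing of differently
coloured edges. The point is that this weight is always `1`; only here does the geometry of the
plane enter.

The parity of the number `n` of crossings of two edges `γ`, `δ` is read off from `F (s, t) = γ s - δ
t` on the unit square. At a transverse interior zero the direction of `F` turns once around, so its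
square root changes sign. Hence `(-1) ^ n` is the monodromy of this square root around the boundary
of the square, up to a correction at each corner where the edges share a vertex
(`RegularArc.sqrtMon_sub`). Along a side of the square, `F` is one edge seen from an end of the
other. Such a side contributes principal square roots at the corners and a sign `η e v` that depends
only on an edge `e` and a vertex `v` (`RegularArc.exists_sqrtHol_sub`,
`RegularArc.neg_one_pow_card`).

Now multiply over all pairs of edges with colours `x`, `x.next`. Every vertex carries exactly one
edge end of each colour. Therefore each `η e v` occurs twice and disappears, the factors of edge
ends at distinct vertices cancel in pairs, and only factors local to the vertices survive
(`prod_next_eq_prod_vertex`). By `sqrtDir_mul_of_clockwise` the factor of a vertex is `-√-1` or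
`√-1` according to the cyclic order of its colours, which is inverse to the node tensor.

The remaining relations are local tensor identities. `Tangle.bracket_glue` carries the Penrose
relation from the contraction of two epsilon tensors to whole diagrams. -/

/-! ### Square roots of directions. -/

/-- The principal square root of the direction of a complex number. -/
noncomputable def sqrtDir (z : ℂ) : ℂ := Complex.exp (Complex.I * (Complex.arg z / 2 : ℝ))

theorem norm_sqrtDir (z : ℂ) : ‖sqrtDir z‖ = 1 := by
  rw [sqrtDir, mul_comm, Complex.norm_exp_ofReal_mul_I]

theorem sqrtDir_ne_zero (z : ℂ) : sqrtDir z ≠ 0 := Complex.exp_ne_zero _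

theorem norm_mul_sqrtDir_sq (z : ℂ) : (‖z‖ : ℂ) * sqrtDir z ^ 2 = z := by
  rw [sqrtDir, ← Complex.exp_nat_mul]
  conv_rhs => rw [← Complex.norm_mul_exp_arg_mul_I z]
  push_cast
  ring_nf

theorem sqrtDir_inv {z : ℂ} (hz : z ∈ Complex.slitPlane) : sqrtDir z⁻¹ = (sqrtDir z)⁻¹ := by
  rw [sqrtDir, sqrtDir, Complex.arg_inv, if_neg (Complex.mem_slitPlane_iff_arg.1 hz).1,
    ← Complex.exp_neg]
  push_cast
  ring_nf

theorem sqrtDir_one : sqrtDir 1 = 1 := by simp [sqrtDir]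

theorem continuousAt_sqrtDir {z : ℂ} (hz : z ∈ Complex.slitPlane) : ContinuousAt sqrtDir z := by
  have := Complex.continuousAt_arg hz
  unfold sqrtDir
  fun_prop

theorem eq_of_real_mul_sq {u v : ℂ} {ρ σ : ℝ} (hρ : 0 < ρ) (hσ : 0 < σ) (hu : ‖u‖ = 1)
    (hv : ‖v‖ = 1) (h : (ρ : ℂ) * u ^ 2 = σ * v ^ 2) : u ^ 2 = v ^ 2 := by
  have h1 := congrArg norm h
  simp only [norm_mul, norm_pow, hu, hv, Complex.norm_real, Real.norm_of_nonneg hρ.le,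
    Real.norm_of_nonneg hσ.le, one_pow, mul_one] at h1
  subst h1
  exact mul_left_cancel₀ (by exact_mod_cast hρ.ne') h

/-- A continuous nonvanishing function on a compact convex set has a continuous square root. -/
theorem exists_continuousOn_sq_eq {E : Type*} [NormedAddCommGroup E] [NormedSpace ℝ E] {K : Set E}
    (hK : IsCompact K) (hc : Convex ℝ K) {F : E → ℂ} (hF : ContinuousOn F K)
    (h0 : ∀ x ∈ K, F x ≠ 0) : ∃ g : E → ℂ, ContinuousOn g K ∧ ∀ x ∈ K, g x ^ 2 = F x := by
  obtain rfl | ⟨x₀, hx₀⟩ := K.eq_empty_or_nonempty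
  · exact ⟨F, by simp, by simp⟩
  obtain ⟨y, hy, hmin⟩ := hK.exists_isMinOn ⟨x₀, hx₀⟩ hF.norm
  have hm : 0 < ‖F y‖ := norm_pos_iff.2 (h0 y hy)
  obtain ⟨d, hd, hd'⟩ := Metric.uniformContinuousOn_iff.1
    (hK.uniformContinuousOn_of_continuous hF) _ hm
  obtain ⟨R, hR⟩ := hK.isBounded.subset_closedBall x₀
  obtain ⟨n, hn⟩ := exists_nat_gt (R / d)
  have hR0 : 0 ≤ R := by simpa using hR hx₀
  have hn0 : 0 < (n : ℝ) := lt_of_le_of_lt (by positivity) hn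
  -- The segment from `x₀` to `x` is cut into `n` pieces, so short that `F` changes along each by
  -- less than its minimal norm. Quotients of consecutive values then lie in the slit plane, and
  -- their principal logarithms add up to a continuous logarithm of `F`.
  let p : ℕ → E → E := fun j x => x₀ + ((j : ℝ) / n) • (x - x₀)
  have hpK : ∀ j ≤ n, ∀ x ∈ K, p j x ∈ K := by
    intro j hj x hx
    have hj' : (j : ℝ) / n ∈ Set.Icc (0 : ℝ) 1 :=
      ⟨by positivity, (div_le_one hn0).2 (by exact_mod_cast hj)⟩
    exact hc.add_smul_sub_mem hx₀ hx hj'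
  have hpc : ∀ j, Continuous (p j) := fun j => by fun_prop
  have hslit : ∀ j < n, ∀ x ∈ K, F (p (j + 1) x) / F (p j x) ∈ Complex.slitPlane := by
    intro j hj x hx
    have k1 := hpK j hj.le x hx
    have k2 := hpK (j + 1) hj x hx
    have hdist : dist (p (j + 1) x) (p j x) < d := by
      have : p (j + 1) x - p j x = (1 / (n : ℝ)) • (x - x₀) := by
        simp only [p, add_sub_add_left_eq_sub, ← sub_smul]
        congr 1
        push_cast
        ring
      have hx' : ‖x - x₀‖ ≤ R := by simpa [dist_eq_norm] using hR hx
      rw [dist_eq_norm, this, norm_smul, Real.norm_of_nonneg (by positivity), one_div,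
        inv_mul_lt_iff₀ hn0]
      rw [div_lt_iff₀ hd] at hn
      linarith
    have h1 := hd' _ k2 _ k1 hdist
    have h2 : ‖F y‖ ≤ ‖F (p j x)‖ := hmin k1
    have h3 : F (p (j + 1) x) / F (p j x) = 1 + (F (p (j + 1) x) - F (p j x)) / F (p j x) := by
      field_simp [h0 _ k1]
      ring
    rw [h3]
    apply Complex.mem_slitPlane_of_norm_lt_one
    rw [norm_div, div_lt_one (norm_pos_iff.2 (h0 _ k1)), ← dist_eq_norm]
    exact h1.trans_le h2
  let Λ : ℕ → E → ℂ := fun m x => Complex.log (F x₀) +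
    ∑ j ∈ Finset.range m, Complex.log (F (p (j + 1) x) / F (p j x))
  have hexp : ∀ m ≤ n, ∀ x ∈ K, Complex.exp (Λ m x) = F (p m x) := by
    intro m
    induction m with
    | zero =>
      intro _ x hx
      simp [Λ, p, Complex.exp_log (h0 _ hx₀)]
    | succ m ih =>
      intro hm x hx
      have := ih (by omega) x hx
      simp only [Λ] at this ⊢
      rw [Finset.sum_range_succ, ← add_assoc, Complex.exp_add, this,
        Complex.exp_log (Complex.slitPlane_ne_zero (hslit m (by omega) x hx)),
        mul_div_cancel₀ _ (h0 _ (hpK m (by omega) x hx))]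
  refine ⟨fun x => Complex.exp (Λ n x / 2), ?_, ?_⟩
  · refine Complex.continuous_exp.comp_continuousOn (ContinuousOn.div_const ?_ _)
    refine continuousOn_const.add (continuousOn_finsetSum _ fun j hj => ?_)
    have hj := Finset.mem_range.1 hj
    refine ContinuousOn.clog (ContinuousOn.div ?_ ?_ ?_) (hslit j hj)
    · exact hF.comp (hpc _).continuousOn (fun x hx => hpK _ hj x hx)
    · exact hF.comp (hpc _).continuousOn (fun x hx => hpK _ hj.le x hx)
    · exact fun x hx => h0 _ (hpK _ hj.le x hx)
  · intro x hx
    rw [← Complex.exp_nat_mul]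
    have : ((2 : ℕ) : ℂ) * (Λ n x / 2) = Λ n x := by push_cast; ring
    rw [this, hexp n le_rfl x hx]
    simp only [p, div_self hn0.ne', one_smul, add_sub_cancel]

/-! ### Holonomy along an interval and monodromy around the square. -/

/-- The holonomy along `[0,1]` of the square root of the direction of `f`; `f` matters only up to
positive factors, and only on the open interval. -/
def SqrtHol (f : ℝ → ℂ) (ζ : ℂ) : Prop :=
  ∃ g : ℝ → ℂ, ContinuousOn g (Set.Icc 0 1) ∧ (∀ s ∈ Set.Icc (0 : ℝ) 1, ‖g s‖ = 1) ∧
    (∀ s ∈ Set.Ioo (0 : ℝ) 1, ∃ ρ : ℝ, 0 < ρ ∧ f s = ρ * g s ^ 2) ∧ ζ = g 1 / g 0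

namespace SqrtHol

variable {f f' : ℝ → ℂ} {ζ ζ' : ℂ}

/-- The squares of two such roots agree on the open interval, hence by continuity at its ends. By
connectedness the roots differ by a global sign, which cancels in the quotient of the end values. -/
theorem unique (h : SqrtHol f ζ) (h' : SqrtHol f ζ') : ζ = ζ' := by
  obtain ⟨g, hc, h1, h2, rfl⟩ := h
  obtain ⟨g', hc', h1', h2', rfl⟩ := h'
  have hsq : Set.EqOn (g ^ 2) (g' ^ 2) (Set.Ioo 0 1) := by
    intro s hs
    obtain ⟨ρ, hρ, e⟩ := h2 s hs
    obtain ⟨σ, hσ, e'⟩ := h2' s hs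
    exact eq_of_real_mul_sq hρ hσ (h1 s (Set.Ioo_subset_Icc_self hs))
      (h1' s (Set.Ioo_subset_Icc_self hs)) (e.symm.trans e')
  have hsq' : Set.EqOn (g ^ 2) (g' ^ 2) (Set.Icc 0 1) :=
    hsq.of_subset_closure (hc.pow 2) (hc'.pow 2) Set.Ioo_subset_Icc_self
      (by rw [closure_Ioo zero_ne_one])
  have hne : ∀ {s : ℝ}, s ∈ Set.Icc (0 : ℝ) 1 → g' s ≠ 0 := by
    intro s hs h
    simpa [h] using h1' s hs
  rcases isPreconnected_Icc.eq_or_eq_neg_of_sq_eq hc hc' hsq' hne with h | h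
  · rw [h (by simp), h (by simp)]
  · rw [h (by simp), h (by simp)]
    simp

theorem congr_pos (h : SqrtHol f ζ)
    (hff : ∀ s ∈ Set.Ioo (0 : ℝ) 1, ∃ ρ : ℝ, 0 < ρ ∧ f' s = ρ * f s) : SqrtHol f' ζ := by
  obtain ⟨g, hc, h1, h2, h3⟩ := h
  refine ⟨g, hc, h1, fun s hs => ?_, h3⟩
  obtain ⟨ρ, hρ, e⟩ := h2 s hs
  obtain ⟨σ, hσ, e'⟩ := hff s hs
  exact ⟨σ * ρ, mul_pos hσ hρ, by rw [e', e]; push_cast; ring⟩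

theorem congr (h : SqrtHol f ζ) (hff : ∀ s ∈ Set.Ioo (0 : ℝ) 1, f' s = f s) : SqrtHol f' ζ :=
  h.congr_pos fun s hs => ⟨1, one_pos, by simp [hff s hs]⟩

theorem mul (h : SqrtHol f ζ) (h' : SqrtHol f' ζ') : SqrtHol (fun s => f s * f' s) (ζ * ζ') := by
  obtain ⟨g, hc, h1, h2, rfl⟩ := h
  obtain ⟨g', hc', h1', h2', rfl⟩ := h'
  refine ⟨fun s => g s * g' s, hc.mul hc', fun s hs => by simp [h1 s hs, h1' s hs],
    fun s hs => ?_, by rw [div_mul_div_comm]⟩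
  obtain ⟨ρ, hρ, e⟩ := h2 s hs
  obtain ⟨σ, hσ, e'⟩ := h2' s hs
  exact ⟨ρ * σ, mul_pos hρ hσ, by simp only [e', e]; push_cast; ring⟩

theorem of_sq {g : ℝ → ℂ} (hc : ContinuousOn g (Set.Icc 0 1))
    (h0 : ∀ s ∈ Set.Icc (0 : ℝ) 1, g s ≠ 0)
    (h : ∀ s ∈ Set.Ioo (0 : ℝ) 1, ∃ ρ : ℝ, 0 < ρ ∧ f s = ρ * g s ^ 2) :
    SqrtHol f ((g 1 / ‖g 1‖) / (g 0 / ‖g 0‖)) := by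
  refine ⟨fun s => g s / ‖g s‖, hc.div (Complex.continuous_ofReal.comp_continuousOn hc.norm) ?_,
    ?_, ?_, rfl⟩
  · intro s hs
    exact_mod_cast norm_ne_zero_iff.2 (h0 s hs)
  · intro s hs
    rw [norm_div, Complex.norm_real, norm_norm, div_self (norm_ne_zero_iff.2 (h0 s hs))]
  · intro s hs
    obtain ⟨ρ, hρ, e⟩ := h s hs
    have hp := norm_pos_iff.2 (h0 s (Set.Ioo_subset_Icc_self hs))
    have hp' : (‖g s‖ : ℂ) ≠ 0 := by exact_mod_cast hp.ne'
    refine ⟨ρ * ‖g s‖ ^ 2, by positivity, ?_⟩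
    rw [e]
    push_cast
    field_simp

/-- The end values of a continuous root are known up to sign from the end directions alone. The sign
left open records how often the curve winds on its way. -/
theorem exists_of_continuousOn {ψ : ℝ → ℂ} (hc : ContinuousOn ψ (Set.Icc 0 1))
    (h0 : ∀ s ∈ Set.Icc (0 : ℝ) 1, ψ s ≠ 0)
    (h : ∀ s ∈ Set.Ioo (0 : ℝ) 1, ∃ ρ : ℝ, 0 < ρ ∧ f s = ρ * ψ s) :
    ∃ ζ, SqrtHol f ζ ∧ (ζ = sqrtDir (ψ 1) / sqrtDir (ψ 0) ∨
      ζ = -(sqrtDir (ψ 1) / sqrtDir (ψ 0))) := by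
  obtain ⟨g, hg, hsq⟩ := exists_continuousOn_sq_eq isCompact_Icc (convex_Icc 0 1) hc h0
  have hne : ∀ s ∈ Set.Icc (0 : ℝ) 1, g s ≠ 0 := by
    intro s hs h
    exact h0 s hs (by rw [← hsq s hs, h]; simp)
  have key : ∀ s ∈ Set.Icc (0 : ℝ) 1, (g s / ‖g s‖) ^ 2 = sqrtDir (ψ s) ^ 2 := by
    intro s hs
    have hp := norm_pos_iff.2 (hne s hs)
    have hp' : (‖g s‖ : ℂ) ≠ 0 := by exact_mod_cast hp.ne'
    refine eq_of_real_mul_sq (ρ := ‖g s‖ ^ 2) (σ := ‖ψ s‖) (by positivity)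
      (norm_pos_iff.2 (h0 s hs)) ?_ (norm_sqrtDir _) ?_
    · rw [norm_div, Complex.norm_real, norm_norm, div_self hp.ne']
    · rw [norm_mul_sqrtDir_sq, ← hsq s hs]
      push_cast
      field_simp
  refine ⟨_, of_sq hg hne fun s hs => ?_, ?_⟩
  · rw [hsq s (Set.Ioo_subset_Icc_self hs)]
    exact h s hs
  · apply sq_eq_sq_iff_eq_or_eq_neg.1
    rw [div_pow (g 1 / _), div_pow (sqrtDir _), key 0 (by simp), key 1 (by simp)]

/-- A curve that avoids the half-line opposite to `c` stays where the principal root, rotated by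
`c`, is continuous, so no sign is left open. -/
theorem of_slitPlane {ψ : ℝ → ℂ} {c : ℂ} (hc0 : c ≠ 0) (hc : ContinuousOn ψ (Set.Icc 0 1))
    (h0 : ∀ s ∈ Set.Icc (0 : ℝ) 1, ψ s / c ∈ Complex.slitPlane)
    (h : ∀ s ∈ Set.Ioo (0 : ℝ) 1, ∃ ρ : ℝ, 0 < ρ ∧ f s = ρ * ψ s) :
    SqrtHol f (sqrtDir (ψ 1 / c) / sqrtDir (ψ 0 / c)) := by
  refine ⟨fun s => sqrtDir (ψ s / c) * sqrtDir c, ?_, ?_, ?_, ?_⟩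
  · refine ContinuousOn.mul (fun s hs => ?_) continuousOn_const
    exact ContinuousAt.comp_continuousWithinAt (f := fun s => ψ s / c)
      (continuousAt_sqrtDir (h0 s hs)) ((hc s hs).div_const c)
  · intro s _
    simp [norm_sqrtDir]
  · intro s hs
    obtain ⟨ρ, hρ, e⟩ := h s hs
    have hs' := h0 s (Set.Ioo_subset_Icc_self hs)
    refine ⟨ρ * (‖ψ s / c‖ * ‖c‖), mul_pos hρ (mul_pos
      (norm_pos_iff.2 (Complex.slitPlane_ne_zero hs')) (norm_pos_iff.2 hc0)), ?_⟩
    have h1 := norm_mul_sqrtDir_sq (ψ s / c)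
    have h2 := norm_mul_sqrtDir_sq c
    calc f s = ρ * ((ψ s / c) * c) := by rw [e, div_mul_cancel₀ _ hc0]
      _ = ρ * ((‖ψ s / c‖ * sqrtDir (ψ s / c) ^ 2) * (‖c‖ * sqrtDir c ^ 2)) := by rw [h1, h2]
      _ = _ := by push_cast; ring
  · rw [mul_div_mul_right _ _ (sqrtDir_ne_zero c)]

theorem const_mul (h : SqrtHol f ζ) {c : ℂ} (hc : c ≠ 0) : SqrtHol (fun s => c * f s) ζ := by
  have : SqrtHol (fun _ => c) 1 := by
    have := of_slitPlane (f := fun _ => c) (ψ := fun _ => c) hc continuousOn_const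
      (by simp [hc]) (fun s _ => ⟨1, one_pos, by simp⟩)
    simpa [hc, sqrtDir_one] using this
  simpa using this.mul h

end SqrtHol

/-- The monodromy around the unit square of the square root of the direction of `F`. -/
def SqrtMon (F : ℝ × ℝ → ℂ) (m : ℂ) : Prop :=
  ∃ a b c d : ℂ, SqrtHol (fun s => F (s, 0)) a ∧ SqrtHol (fun t => F (1, t)) b ∧
    SqrtHol (fun s => F (s, 1)) c ∧ SqrtHol (fun t => F (0, t)) d ∧ m = a * b / (c * d)

namespace SqrtMon

variable {F F' : ℝ × ℝ → ℂ} {m m' : ℂ}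

theorem unique (h : SqrtMon F m) (h' : SqrtMon F m') : m = m' := by
  obtain ⟨a, b, c, d, ha, hb, hc, hd, rfl⟩ := h
  obtain ⟨a', b', c', d', ha', hb', hc', hd', rfl⟩ := h'
  rw [ha.unique ha', hb.unique hb', hc.unique hc', hd.unique hd']

theorem mul (h : SqrtMon F m) (h' : SqrtMon F' m') : SqrtMon (fun x => F x * F' x) (m * m') := by
  obtain ⟨a, b, c, d, ha, hb, hc, hd, rfl⟩ := h
  obtain ⟨a', b', c', d', ha', hb', hc', hd', rfl⟩ := h'
  exact ⟨_, _, _, _, ha.mul ha', hb.mul hb', hc.mul hc', hd.mul hd', by ring⟩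

theorem congr (h : SqrtMon F m) (hF : ∀ x ∈ Set.Icc (0 : ℝ) 1 ×ˢ Set.Icc (0 : ℝ) 1, F' x = F x) :
    SqrtMon F' m := by
  obtain ⟨a, b, c, d, ha, hb, hc, hd, h⟩ := h
  refine ⟨a, b, c, d, ha.congr fun s hs => ?_, hb.congr fun s hs => ?_, hc.congr fun s hs => ?_,
    hd.congr fun s hs => ?_, h⟩ <;>
  exact hF _ ⟨by simp [hs.1.le, hs.2.le], by simp [hs.1.le, hs.2.le]⟩

/-- A square root exists on the whole square, so the four holonomies are quotients of its normalized
corner values and cancel. -/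
theorem of_continuousOn (hc : ContinuousOn F (Set.Icc (0 : ℝ) 1 ×ˢ Set.Icc (0 : ℝ) 1))
    (h0 : ∀ x ∈ Set.Icc (0 : ℝ) 1 ×ˢ Set.Icc (0 : ℝ) 1, F x ≠ 0) : SqrtMon F 1 := by
  obtain ⟨g, hg, hsq⟩ := exists_continuousOn_sq_eq (isCompact_Icc.prod isCompact_Icc)
    ((convex_Icc 0 1).prod (convex_Icc 0 1)) hc h0
  have hne : ∀ x ∈ Set.Icc (0 : ℝ) 1 ×ˢ Set.Icc (0 : ℝ) 1, g x ≠ 0 := by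
    intro x hx h
    exact h0 x hx (by rw [← hsq x hx, h]; simp)
  have side : ∀ p : ℝ → ℝ × ℝ, Continuous p →
      (∀ s ∈ Set.Icc (0 : ℝ) 1, p s ∈ Set.Icc (0 : ℝ) 1 ×ˢ Set.Icc (0 : ℝ) 1) →
      SqrtHol (fun s => F (p s)) ((g (p 1) / ‖g (p 1)‖) / (g (p 0) / ‖g (p 0)‖)) := by
    intro p hp hpK
    refine SqrtHol.of_sq (g := fun s => g (p s)) (hg.comp hp.continuousOn hpK)
      (fun s hs => hne _ (hpK s hs)) fun s hs => ⟨1, one_pos, ?_⟩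
    rw [hsq _ (hpK s (Set.Ioo_subset_Icc_self hs))]
    simp
  refine ⟨_, _, _, _, side (fun s => (s, 0)) (by fun_prop) (by simp),
    side (fun s => (1, s)) (by fun_prop) (by simp),
    side (fun s => (s, 1)) (by fun_prop) (by simp),
    side (fun s => (0, s)) (by fun_prop) (by simp), ?_⟩
  have hn : ∀ x ∈ Set.Icc (0 : ℝ) 1 ×ˢ Set.Icc (0 : ℝ) 1, g x / ‖g x‖ ≠ 0 := fun x hx =>
    div_ne_zero (hne x hx) (by exact_mod_cast norm_ne_zero_iff.2 (hne x hx))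
  have h1 := hn (0, 0) (by simp)
  have h2 := hn (0, 1) (by simp)
  have h3 := hn (1, 0) (by simp)
  have h4 := hn (1, 1) (by simp)
  generalize g (0, 0) / (‖g (0, 0)‖ : ℂ) = a at *
  generalize g (0, 1) / (‖g (0, 1)‖ : ℂ) = b at *
  generalize g (1, 0) / (‖g (1, 0)‖ : ℂ) = c at *
  generalize g (1, 1) / (‖g (1, 1)‖ : ℂ) = d at *
  field_simp

theorem prod {ι : Type*} {L : ι → ℝ × ℝ → ℂ} {m : ι → ℂ} (S : Finset ι)
    (h : ∀ i ∈ S, SqrtMon (L i) (m i)) : SqrtMon (fun x => ∏ i ∈ S, L i x) (∏ i ∈ S, m i) := by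
  classical
  induction S using Finset.induction_on with
  | empty => simpa using of_continuousOn (F := fun _ => 1) continuousOn_const (by simp)
  | insert i S hi ih =>
    simp only [Finset.prod_insert hi]
    exact (h i (by simp)).mul (ih fun j hj => h j (by simp [hj]))

end SqrtMon

/-! ### Linear models of the zeros: monodromy and approximation. -/

/-- The linear model of `γ s - δ t` near a common point `γ k.1 = δ k.2` of two curves with
velocities `p` and `q`. -/
def meetModel (p q : ℂ) (k x : ℝ × ℝ) : ℂ :=
  p * ((x.1 - k.1 : ℝ) : ℂ) - q * ((x.2 - k.2 : ℝ) : ℂ)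

theorem im_div_pos_iff {z w : ℂ} (hw : w ≠ 0) : 0 < (z / w).im ↔ 0 < (conj w * z).im := by
  have h : z / w = ((Complex.normSq w)⁻¹ : ℝ) * (conj w * z) := by
    rw [div_eq_mul_inv, Complex.inv_def]; push_cast; ring
  rw [h, Complex.im_ofReal_mul]
  exact mul_pos_iff_of_pos_left (inv_pos.2 (Complex.normSq_pos.2 hw))

theorem im_div_neg_iff {z w : ℂ} (hw : w ≠ 0) : (z / w).im < 0 ↔ (conj w * z).im < 0 := by
  have h := im_div_pos_iff (z := -z) hw
  simpa [neg_div] using h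

/-- The arguments on the left have their sum in `(0, 2π)`, those on the right in `(-2π, 0)`, and the
two sums agree modulo `2π`. They differ by exactly `2π`, so the half sums differ by `π`. -/
theorem sqrtDir_quad {z₁ z₂ z₃ z₄ : ℂ} (h : z₁ * z₂ = z₃ * z₄) (h₁ : 0 < z₁.im) (h₂ : 0 < z₂.im)
    (h₃ : z₃.im < 0) (h₄ : z₄.im < 0) :
    sqrtDir z₁ * sqrtDir z₂ = -(sqrtDir z₃ * sqrtDir z₄) := by
  have ne : ∀ z : ℂ, z.im ≠ 0 → z ≠ 0 := fun z hz h => hz (by simp [h])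
  have pos : ∀ z : ℂ, 0 < z.im → 0 < z.arg ∧ z.arg < Real.pi := fun z hz =>
    ⟨lt_of_le_of_ne (Complex.arg_nonneg_iff.2 hz.le)
      (fun h => hz.ne' (Complex.arg_eq_zero_iff.1 h.symm).2),
      lt_of_le_of_ne (Complex.arg_le_pi z) (fun h => hz.ne' (Complex.arg_eq_pi_iff.1 h).2)⟩
  have neg : ∀ z : ℂ, z.im < 0 → -Real.pi < z.arg ∧ z.arg < 0 := fun z hz =>
    ⟨Complex.neg_pi_lt_arg z, Complex.arg_neg_iff.2 hz⟩
  obtain ⟨a1, a2⟩ := pos _ h₁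
  obtain ⟨b1, b2⟩ := pos _ h₂
  obtain ⟨c1, c2⟩ := neg _ h₃
  obtain ⟨d1, d2⟩ := neg _ h₄
  have key : ((z₁.arg + z₂.arg : ℝ) : Real.Angle) = ((z₃.arg + z₄.arg : ℝ) : Real.Angle) := by
    rw [Real.Angle.coe_add, Real.Angle.coe_add,
      ← Complex.arg_mul_coe_angle (ne _ h₁.ne') (ne _ h₂.ne'),
      ← Complex.arg_mul_coe_angle (ne _ h₃.ne) (ne _ h₄.ne), h]
  obtain ⟨n, hn⟩ := Real.Angle.angle_eq_iff_two_pi_dvd_sub.1 key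
  have hn1 : n = 1 := by
    have hpi := Real.pi_pos
    have l : (0 : ℝ) < n := by
      by_contra! hc
      nlinarith
    have r : (n : ℝ) < 2 := by
      by_contra! hc
      nlinarith
    have l' : 0 < n := by exact_mod_cast l
    have r' : n < 2 := by exact_mod_cast r
    omega
  subst hn1
  have hsum : Complex.I * ((z₁.arg / 2 : ℝ) : ℂ) + Complex.I * ((z₂.arg / 2 : ℝ) : ℂ) =
      Real.pi * Complex.I +
        (Complex.I * ((z₃.arg / 2 : ℝ) : ℂ) + Complex.I * ((z₄.arg / 2 : ℝ) : ℂ)) := by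
    have : z₁.arg = z₃.arg + z₄.arg + 2 * Real.pi - z₂.arg := by push_cast at hn; linarith
    rw [this]
    push_cast
    ring
  simp only [sqrtDir, ← Complex.exp_add]
  rw [hsum, Complex.exp_add, Complex.exp_pi_mul_I]
  ring

/-- As `Q / P` is not real, the segment misses the half-line opposite to `P`. -/
theorem SqrtHol.segment {P Q : ℂ} (hP : P ≠ 0) (h : (Q / P).im ≠ 0) {f : ℝ → ℂ}
    (hf : ∀ s, f s = P + s * (Q - P)) : SqrtHol f (sqrtDir (Q / P)) := by
  obtain rfl : f = fun s : ℝ => P + s * (Q - P) := funext hf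
  have := SqrtHol.of_slitPlane (f := fun s : ℝ => P + s * (Q - P))
    (ψ := fun s : ℝ => P + s * (Q - P)) hP (by fun_prop) ?_ (fun s _ => ⟨1, one_pos, by simp⟩)
  · simpa [hP, sqrtDir_one] using this
  · intro s _
    have e : (P + s * (Q - P)) / P = ((1 - s : ℝ) : ℂ) + (s : ℝ) * (Q / P) := by
      field_simp
      push_cast
      ring
    rw [e, Complex.mem_slitPlane_iff]
    by_cases hs : s = 0
    · left; simp [hs]
    · right
      simp [-Complex.ofReal_sub, hs, h]

/-- The model maps the square onto a parallelogram around `0`. Going around it, all four sides turn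
in the same direction, each by less than `π`. The two paths from `P₁` to `P₃` thus pass `0` on
opposite sides, as `sqrtDir_quad` requires. -/
theorem SqrtMon.meetModel_of_mem_Ioo {p q : ℂ} {k : ℝ × ℝ} (h1 : k.1 ∈ Set.Ioo (0 : ℝ) 1)
    (h2 : k.2 ∈ Set.Ioo (0 : ℝ) 1) (hpq : (conj p * q).im ≠ 0) :
    SqrtMon (meetModel p q k) (-1) := by
  obtain ⟨a, b⟩ := k
  obtain ⟨a0, a1⟩ := h1
  obtain ⟨b0, b1⟩ := h2
  simp only at a0 a1 b0 b1
  obtain ⟨J, hJ⟩ : ∃ J, J = (conj p * q).im := ⟨_, rfl⟩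
  rw [← hJ] at hpq
  -- Cross products of values of the model are real multiples of the cross product `J` of the
  -- velocities, which gives the sense of turning of each side.
  have cross : ∀ u v u' v' : ℝ, (conj (p * (u : ℂ) - q * (v : ℂ)) *
      (p * (u' : ℂ) - q * (v' : ℂ))).im = (u' * v - u * v') * J := by
    intro u v u' v'
    rw [hJ]
    simp only [map_sub, map_mul, Complex.conj_ofReal, Complex.mul_im, Complex.sub_re,
      Complex.sub_im, Complex.mul_re, Complex.conj_re, Complex.conj_im, Complex.ofReal_re,
      Complex.ofReal_im]
    ring
  have ne : ∀ z w : ℂ, (conj z * w).im ≠ 0 → z ≠ 0 := fun z w h h' => h (by simp [h'])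
  have c12 := cross (0 - a) (0 - b) (1 - a) (0 - b)
  have c23 := cross (1 - a) (0 - b) (1 - a) (1 - b)
  have c43 := cross (0 - a) (1 - b) (1 - a) (1 - b)
  have c14 := cross (0 - a) (0 - b) (0 - a) (1 - b)
  have e12 : (1 - a) * (0 - b) - (0 - a) * (0 - b) = -b := by ring
  have e23 : (1 - a) * (0 - b) - (1 - a) * (1 - b) = -(1 - a) := by ring
  have e43 : (1 - a) * (1 - b) - (0 - a) * (1 - b) = 1 - b := by ring
  have e14 : (0 - a) * (0 - b) - (0 - a) * (1 - b) = a := by ring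
  rw [e12] at c12
  rw [e23] at c23
  rw [e43] at c43
  rw [e14] at c14
  obtain ⟨P₁, hP₁⟩ : ∃ P, P = p * ((0 - a : ℝ) : ℂ) - q * ((0 - b : ℝ) : ℂ) := ⟨_, rfl⟩
  obtain ⟨P₂, hP₂⟩ : ∃ P, P = p * ((1 - a : ℝ) : ℂ) - q * ((0 - b : ℝ) : ℂ) := ⟨_, rfl⟩
  obtain ⟨P₃, hP₃⟩ : ∃ P, P = p * ((1 - a : ℝ) : ℂ) - q * ((1 - b : ℝ) : ℂ) := ⟨_, rfl⟩
  obtain ⟨P₄, hP₄⟩ : ∃ P, P = p * ((0 - a : ℝ) : ℂ) - q * ((1 - b : ℝ) : ℂ) := ⟨_, rfl⟩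
  rw [← hP₁, ← hP₂] at c12
  rw [← hP₂, ← hP₃] at c23
  rw [← hP₄, ← hP₃] at c43
  rw [← hP₁, ← hP₄] at c14
  have a1' : 0 < 1 - a := by linarith
  have b1' : 0 < 1 - b := by linarith
  have n1 : P₁ ≠ 0 := ne _ P₂ (by rw [c12]; exact mul_ne_zero (by linarith) hpq)
  have n2 : P₂ ≠ 0 := ne _ P₃ (by rw [c23]; exact mul_ne_zero (by linarith) hpq)
  have n4 : P₄ ≠ 0 := ne _ P₃ (by rw [c43]; exact mul_ne_zero (by linarith) hpq)
  have hprod : P₂ / P₁ * (P₃ / P₂) = P₃ / P₄ * (P₄ / P₁) := by field_simp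
  have im_ne : ∀ z w : ℂ, z ≠ 0 → (conj z * w).im ≠ 0 → (w / z).im ≠ 0 := by
    intro z w hz h
    rcases lt_or_gt_of_ne h with h | h
    · exact ((im_div_neg_iff hz).2 h).ne
    · exact ((im_div_pos_iff hz).2 h).ne'
  have hval : sqrtDir (P₂ / P₁) * sqrtDir (P₃ / P₂) =
      -(sqrtDir (P₃ / P₄) * sqrtDir (P₄ / P₁)) := by
    rcases lt_or_gt_of_ne hpq with hJ' | hJ'
    · refine sqrtDir_quad hprod ((im_div_pos_iff n1).2 ?_) ((im_div_pos_iff n2).2 ?_)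
        ((im_div_neg_iff n4).2 ?_) ((im_div_neg_iff n1).2 ?_)
      · rw [c12]; nlinarith
      · rw [c23]; nlinarith
      · rw [c43]; nlinarith
      · rw [c14]; nlinarith
    · rw [eq_neg_iff_add_eq_zero, add_comm, ← eq_neg_iff_add_eq_zero]
      refine sqrtDir_quad hprod.symm ((im_div_pos_iff n4).2 ?_) ((im_div_pos_iff n1).2 ?_)
        ((im_div_neg_iff n1).2 ?_) ((im_div_neg_iff n2).2 ?_)
      · rw [c43]; nlinarith
      · rw [c14]; nlinarith
      · rw [c12]; nlinarith
      · rw [c23]; nlinarith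
  refine ⟨sqrtDir (P₂ / P₁), sqrtDir (P₃ / P₂), sqrtDir (P₃ / P₄), sqrtDir (P₄ / P₁),
    SqrtHol.segment n1 (im_ne _ _ n1 ?_) ?_, SqrtHol.segment n2 (im_ne _ _ n2 ?_) ?_,
    SqrtHol.segment n4 (im_ne _ _ n4 ?_) ?_, SqrtHol.segment n1 (im_ne _ _ n1 ?_) ?_, ?_⟩
  · rw [c12]; exact mul_ne_zero (by linarith) hpq
  · intro s
    simp only [meetModel, hP₁, hP₂]; push_cast; ring
  · rw [c23]; exact mul_ne_zero (by linarith) hpq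
  · intro s
    simp only [meetModel, hP₃, hP₂]; push_cast; ring
  · rw [c43]; exact mul_ne_zero (by linarith) hpq
  · intro s
    simp only [meetModel, hP₃, hP₄]; push_cast; ring
  · rw [c14]; exact mul_ne_zero (by linarith) hpq
  · intro s
    simp only [meetModel, hP₁, hP₄]; push_cast; ring
  · rw [hval, neg_div, div_self (mul_ne_zero (sqrtDir_ne_zero _) (sqrtDir_ne_zero _))]

/-- This is how distinct directions at a vertex are used: the quotient avoids the cut, where
`sqrtDir` is discontinuous and incompatible with inversion. -/
theorem neg_div_mem_slitPlane {x y : ℂ} (hx : x ≠ 0) (h : ¬ SameRay ℝ x y) :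
    -y / x ∈ Complex.slitPlane := by
  rw [Complex.mem_slitPlane_iff]
  by_contra! hc
  apply h
  obtain ⟨h1, h2⟩ := hc
  have e : y = ((-(-y / x).re : ℝ) : ℂ) * x := by
    have e1 : ((-(-y / x).re : ℝ) : ℂ) = -(-y / x) := by
      apply Complex.ext
      · simp
      · simp only [Complex.ofReal_im, Complex.neg_im, h2, neg_zero]
    rw [e1]
    field_simp
  rw [e, ← Complex.real_smul]
  exact SameRay.sameRay_nonneg_smul_right x (by linarith)

theorem add_mul_mem_slitPlane {w : ℂ} (hw : w ∈ Complex.slitPlane) {u v : ℝ} (hu : 0 ≤ u)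
    (hv : 0 ≤ v) (huv : 0 < u + v) : (u : ℂ) + v * w ∈ Complex.slitPlane := by
  rw [Complex.mem_slitPlane_iff] at hw ⊢
  simp only [Complex.add_re, Complex.ofReal_re, Complex.re_ofReal_mul, Complex.add_im,
    Complex.ofReal_im, Complex.im_ofReal_mul, zero_add]
  rcases hv.eq_or_lt with rfl | hv
  · left; linarith
  · rcases hw with hw | hw
    · left; positivity
    · right; exact mul_ne_zero hv.ne' hw

/-- After division by `x` the curve lies in the cone spanned by `1` and `-y / x`, which without its
apex is contained in the slit plane. -/
theorem SqrtHol.cone {x y : ℂ} (hx : x ≠ 0) (h : ¬ SameRay ℝ x y) {u v : ℝ → ℝ}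
    (hu : Continuous u) (hv : Continuous v) (hu0 : ∀ s ∈ Set.Icc (0 : ℝ) 1, 0 ≤ u s)
    (hv0 : ∀ s ∈ Set.Icc (0 : ℝ) 1, 0 ≤ v s) (huv : ∀ s ∈ Set.Icc (0 : ℝ) 1, 0 < u s + v s)
    {f : ℝ → ℂ} (hf : ∀ s, f s = x * u s - y * v s) :
    SqrtHol f (sqrtDir (u 1 + v 1 * (-y / x)) / sqrtDir (u 0 + v 0 * (-y / x))) := by
  obtain rfl : f = fun s : ℝ => x * u s - y * v s := funext hf
  have e : ∀ s, (x * u s - y * v s) / x = u s + v s * (-y / x) := by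
    intro s
    field_simp
    ring
  have := SqrtHol.of_slitPlane (f := fun s : ℝ => x * u s - y * v s)
    (ψ := fun s : ℝ => x * u s - y * v s) hx (by fun_prop) ?_ (fun s _ => ⟨1, one_pos, by simp⟩)
  · simpa only [e] using this
  · intro s hs
    rw [e]
    exact add_mul_mem_slitPlane (neg_div_mem_slitPlane hx h) (hu0 s hs) (hv0 s hs) (huv s hs)

theorem SqrtHol.ray {x : ℂ} (hx : x ≠ 0) {u : ℝ → ℝ} (hu : ∀ s ∈ Set.Ioo (0 : ℝ) 1, 0 < u s)
    {f : ℝ → ℂ} (hf : ∀ s, f s = x * u s) : SqrtHol f 1 := by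
  have := SqrtHol.of_slitPlane (f := f) (ψ := fun _ => x) hx continuousOn_const (by simp [hx])
    (fun s hs => ⟨u s, hu s hs, by rw [hf, mul_comm]⟩)
  simpa [hx, sqrtDir_one] using this

/-- The parameter of an end of `[0,1]`. -/
def endParam (b : Bool) : ℝ := if b then 1 else 0

/-- The sign that turns a velocity at an end of `[0,1]` into an inward pointing one. -/
def endSign (b : Bool) : ℝ := if b then -1 else 1

/-- The two sides through the corner run along rays and have trivial holonomy. The other two stay in
the cone spanned by the inward tangent `x` and by `-y`, and together they turn the direction from
one to the other. The sense in which the boundary of the square runs through this cone depends on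
whether `i = j`. -/
theorem SqrtMon.meetModel_endParam {p q : ℂ} {i j : Bool} (hp : p ≠ 0) (hq : q ≠ 0)
    (h : ¬ SameRay ℝ (endSign i * p) (endSign j * q)) :
    SqrtMon (meetModel p q (endParam i, endParam j))
      (if i = j then sqrtDir (-(endSign j * q) / (endSign i * p))
        else (sqrtDir (-(endSign j * q) / (endSign i * p)))⁻¹) := by
  obtain ⟨x, hx⟩ : ∃ x, x = endSign i * p := ⟨_, rfl⟩
  obtain ⟨y, hy⟩ : ∃ y, y = endSign j * q := ⟨_, rfl⟩
  rw [← hx, ← hy] at h ⊢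
  have hx0 : x ≠ 0 := by rw [hx]; cases i <;> simpa [endSign]
  have hy0 : -y ≠ 0 := by rw [hy]; cases j <;> simpa [endSign]
  have key : ∀ m, (∃ a b c d, SqrtHol (fun s => meetModel p q (endParam i, endParam j) (s, 0)) a ∧
    SqrtHol (fun s => meetModel p q (endParam i, endParam j) (1, s)) b ∧
    SqrtHol (fun s => meetModel p q (endParam i, endParam j) (s, 1)) c ∧
    SqrtHol (fun s => meetModel p q (endParam i, endParam j) (0, s)) d ∧ m = a * b / (c * d)) →
    SqrtMon (meetModel p q (endParam i, endParam j)) m := fun m h => h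
  have w0 := sqrtDir_ne_zero (-y / x)
  have w1 := sqrtDir_ne_zero (1 + -y / x)
  apply key
  cases i <;> cases j <;>
    simp only [endSign, endParam, if_true, Bool.false_eq_true, if_false, Complex.ofReal_one,
      Complex.ofReal_neg, one_mul, neg_mul, reduceCtorEq] at hx hy ⊢
  · refine ⟨_, _, _, _, SqrtHol.ray (x := x) hx0 (u := fun s => s) (fun s hs => hs.1) ?_,
      SqrtHol.cone hx0 h (u := fun _ => 1) (v := fun t => t) (by fun_prop) (by fun_prop)
        (by simp) (by simp +contextual) (fun s hs => by linarith [hs.1]) ?_,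
      SqrtHol.cone hx0 h (u := fun s => s) (v := fun _ => 1) (by fun_prop) (by fun_prop)
        (by simp +contextual) (by simp) (fun s hs => by linarith [hs.1]) ?_,
      SqrtHol.ray (x := -y) hy0 (u := fun s => s) (fun s hs => hs.1) ?_, ?_⟩
    · intro s; simp [meetModel, hx]
    · intro s; simp [meetModel, hx, hy]
    · intro s; simp [meetModel, hx, hy]
    · intro s; simp [meetModel, hy]
    · simp only [Complex.ofReal_zero, Complex.ofReal_one, zero_mul, one_mul,
        zero_add, add_zero, sqrtDir_one]
      generalize sqrtDir (-y / x) = A at *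
      generalize sqrtDir (1 + -y / x) = B at *
      field_simp
  · refine ⟨_, _, _, _,
      SqrtHol.cone hx0 h (u := fun s => s) (v := fun _ => 1) (by fun_prop) (by fun_prop)
        (by simp +contextual) (by simp) (fun s hs => by linarith [hs.1]) ?_,
      SqrtHol.cone hx0 h (u := fun _ => 1) (v := fun t => 1 - t) (by fun_prop) (by fun_prop)
        (by simp) (by simp +contextual) (fun s hs => by linarith [hs.2]) ?_,
      SqrtHol.ray (x := x) hx0 (u := fun s => s) (fun s hs => hs.1) ?_,
      SqrtHol.ray (x := -y) hy0 (u := fun s => 1 - s) (fun s hs => by linarith [hs.2]) ?_, ?_⟩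
    · intro s; simp [meetModel, hx, hy]
    · intro s; simp [meetModel, hx, hy]; ring
    · intro s; simp [meetModel, hx]
    · intro s; simp [meetModel, hy]; ring
    · simp only [sub_self, sub_zero, Complex.ofReal_zero, Complex.ofReal_one, zero_mul, one_mul,
        zero_add, add_zero, sqrtDir_one]
      generalize sqrtDir (-y / x) = A at *
      generalize sqrtDir (1 + -y / x) = B at *
      field_simp
  · refine ⟨_, _, _, _,
      SqrtHol.ray (x := x) hx0 (u := fun s => 1 - s) (fun s hs => by linarith [hs.2]) ?_,
      SqrtHol.ray (x := -y) hy0 (u := fun s => s) (fun s hs => hs.1) ?_,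
      SqrtHol.cone hx0 h (u := fun s => 1 - s) (v := fun _ => 1) (by fun_prop) (by fun_prop)
        (by simp +contextual) (by simp) (fun s hs => by linarith [hs.2]) ?_,
      SqrtHol.cone hx0 h (u := fun _ => 1) (v := fun t => t) (by fun_prop) (by fun_prop)
        (by simp) (by simp +contextual) (fun s hs => by linarith [hs.1]) ?_, ?_⟩
    · intro s; simp [meetModel, hx]; ring
    · intro s; simp [meetModel, hy]
    · intro s; simp [meetModel, hx, hy]; ring
    · intro s; simp [meetModel, hx, hy]
    · simp only [sub_self, sub_zero, Complex.ofReal_zero, Complex.ofReal_one, zero_mul, one_mul,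
        zero_add, add_zero, sqrtDir_one]
      generalize sqrtDir (-y / x) = A at *
      generalize sqrtDir (1 + -y / x) = B at *
      field_simp
  · refine ⟨_, _, _, _,
      SqrtHol.cone hx0 h (u := fun s => 1 - s) (v := fun _ => 1) (by fun_prop) (by fun_prop)
        (by simp +contextual) (by simp) (fun s hs => by linarith [hs.2]) ?_,
      SqrtHol.ray (x := -y) hy0 (u := fun s => 1 - s) (fun s hs => by linarith [hs.2]) ?_,
      SqrtHol.ray (x := x) hx0 (u := fun s => 1 - s) (fun s hs => by linarith [hs.2]) ?_,
      SqrtHol.cone hx0 h (u := fun _ => 1) (v := fun t => 1 - t) (by fun_prop) (by fun_prop)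
        (by simp) (by simp +contextual) (fun s hs => by linarith [hs.2]) ?_, ?_⟩
    · intro s; simp [meetModel, hx, hy]; ring
    · intro s; simp [meetModel, hy]; ring
    · intro s; simp [meetModel, hx]; ring
    · intro s; simp [meetModel, hx, hy]; ring
    · simp only [sub_self, sub_zero, Complex.ofReal_zero, Complex.ofReal_one, zero_mul, one_mul,
        zero_add, add_zero, sqrtDir_one]
      generalize sqrtDir (-y / x) = A at *
      generalize sqrtDir (1 + -y / x) = B at *
      field_simp

/-- Cramer's rule: the cross product with one velocity isolates the coefficient of the other. -/
theorem abs_le_norm_meetModel {p q : ℂ} (hpq : (conj p * q).im ≠ 0) (k x : ℝ × ℝ) :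
    |x.1 - k.1| ≤ ‖q‖ / |(conj p * q).im| * ‖meetModel p q k x‖ ∧
      |x.2 - k.2| ≤ ‖p‖ / |(conj p * q).im| * ‖meetModel p q k x‖ := by
  have hJ := abs_pos.2 hpq
  constructor
  · rw [div_mul_eq_mul_div, le_div_iff₀ hJ, ← abs_mul]
    have : (x.1 - k.1) * (conj p * q).im = -(conj q * meetModel p q k x).im := by
      simp only [meetModel, Complex.mul_im, Complex.conj_re, Complex.conj_im, Complex.sub_re,
        Complex.sub_im, Complex.mul_re, Complex.ofReal_re, Complex.ofReal_im]
      ring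
    rw [this, abs_neg]
    refine (Complex.abs_im_le_norm _).trans ?_
    rw [norm_mul, Complex.norm_conj]
  · rw [div_mul_eq_mul_div, le_div_iff₀ hJ, ← abs_mul]
    have : (x.2 - k.2) * (conj p * q).im = -(conj p * meetModel p q k x).im := by
      simp only [meetModel, Complex.mul_im, Complex.conj_re, Complex.conj_im, Complex.sub_re,
        Complex.sub_im, Complex.mul_re, Complex.ofReal_re, Complex.ofReal_im]
      ring
    rw [this, abs_neg]
    refine (Complex.abs_im_le_norm _).trans ?_
    rw [norm_mul, Complex.norm_conj]

theorem endSign_mul_sub (b : Bool) {s : ℝ} (hs : s ∈ Set.Icc (0 : ℝ) 1) :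
    endSign b * (s - endParam b) = |s - endParam b| := by
  cases b
  · simp [endSign, endParam, abs_of_nonneg hs.1]
  · simp [endSign, endParam, abs_of_nonpos (sub_nonpos.2 hs.2)]

theorem endSign_mul_self (b : Bool) : endSign b * endSign b = 1 := by
  cases b <;> simp [endSign]

/-- Two edges may leave a vertex in opposite directions, and then the model is degenerate on the
plane. On the quadrant at the corner it is still injective: there `-y` is a positive multiple `w` of
`x`, so the two contributions add up without cancellation. -/
theorem exists_abs_le_norm_meetModel {p q : ℂ} {i j : Bool} (hp : p ≠ 0)
    (h : ¬ SameRay ℝ (endSign i * p) (endSign j * q)) :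
    ∃ C : ℝ, ∀ x ∈ Set.Icc (0 : ℝ) 1 ×ˢ Set.Icc (0 : ℝ) 1,
      |x.1 - endParam i| ≤ C * ‖meetModel p q (endParam i, endParam j) x‖ ∧
      |x.2 - endParam j| ≤ C * ‖meetModel p q (endParam i, endParam j) x‖ := by
  by_cases hpq : (conj p * q).im = 0
  · have hx0 : (endSign i * p : ℂ) ≠ 0 := by cases i <;> simpa [endSign]
    have him : (-(endSign j * q) / (endSign i * p)).im = 0 := by
      have e : conj (endSign i * p) * (-(endSign j * q)) =
          ((-(endSign i * endSign j) : ℝ) : ℂ) * (conj p * q) := by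
        simp only [map_mul, Complex.conj_ofReal]
        push_cast
        ring
      have e' : (conj (endSign i * p) * (-(endSign j * q))).im = 0 := by
        rw [e, Complex.im_ofReal_mul, hpq, mul_zero]
      apply le_antisymm
      · exact not_lt.1 fun h => ((im_div_pos_iff hx0).1 h).ne' e'
      · exact not_lt.1 fun h => ((im_div_neg_iff hx0).1 h).ne e'
    have hre := (Complex.mem_slitPlane_iff.1 (neg_div_mem_slitPlane hx0 h)).resolve_right
      (not_not.2 him)
    obtain ⟨w, hw⟩ : ∃ w, w = (-(endSign j * q) / (endSign i * p)).re := ⟨_, rfl⟩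
    rw [← hw] at hre
    have hqe : -(endSign j * q : ℂ) = w * (endSign i * p) := by
      have : ((w : ℝ) : ℂ) = -(endSign j * q) / (endSign i * p) := by
        apply Complex.ext
        · simpa using hw
        · rw [him, Complex.ofReal_im]
      rw [this, div_mul_cancel₀ _ hx0]
    have hn : ‖(endSign i * p : ℂ)‖ = ‖p‖ := by cases i <;> simp [endSign]
    have hp' := norm_pos_iff.2 hp
    have sq : ∀ b : Bool, (endSign b : ℂ) * endSign b = 1 := by
      intro b; exact_mod_cast endSign_mul_self b
    have val : ∀ x ∈ Set.Icc (0 : ℝ) 1 ×ˢ Set.Icc (0 : ℝ) 1,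
        ‖meetModel p q (endParam i, endParam j) x‖ =
          (|x.1 - endParam i| + w * |x.2 - endParam j|) * ‖p‖ := by
      intro x hx
      have : meetModel p q (endParam i, endParam j) x =
          ((|x.1 - endParam i| + w * |x.2 - endParam j| : ℝ) : ℂ) * (endSign i * p) := by
        rw [← endSign_mul_sub i hx.1, ← endSign_mul_sub j hx.2]
        simp only [meetModel]
        push_cast
        linear_combination (-(p * (x.1 - endParam i))) * sq i +
          (q * (x.2 - endParam j)) * sq j + endSign j * (x.2 - endParam j) * hqe
      rw [this, norm_mul, hn, Complex.norm_real, Real.norm_of_nonneg (by positivity)]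
    refine ⟨(1 + 1 / w) / ‖p‖, fun x hx => ?_⟩
    rw [val x hx]
    have e : (1 + 1 / w) / ‖p‖ * ((|x.1 - endParam i| + w * |x.2 - endParam j|) * ‖p‖) =
        |x.1 - endParam i| + |x.2 - endParam j| + |x.1 - endParam i| / w +
          w * |x.2 - endParam j| := by
      field_simp
      ring
    rw [e]
    have t1 := abs_nonneg (x.1 - endParam i)
    have t2 := abs_nonneg (x.2 - endParam j)
    have t3 : 0 ≤ |x.1 - endParam i| / w := by positivity
    have t4 : 0 ≤ w * |x.2 - endParam j| := by positivity
    constructor <;> linarith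
  · refine ⟨max (‖q‖ / |(conj p * q).im|) (‖p‖ / |(conj p * q).im|), fun x _ => ?_⟩
    obtain ⟨h1, h2⟩ := abs_le_norm_meetModel hpq (endParam i, endParam j) x
    exact ⟨h1.trans (mul_le_mul_of_nonneg_right (le_max_left _ _) (norm_nonneg _)),
      h2.trans (mul_le_mul_of_nonneg_right (le_max_right _ _) (norm_nonneg _))⟩

-- The error of the linear approximation is small compared with the distance to `k`, which by `hC`
-- is controlled by the model.
open Asymptotics Filter Topology in
theorem tendsto_sub_div_meetModel {γ δ : ℝ → ℂ} {p q : ℂ} {k : ℝ × ℝ}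
    (hγ : HasDerivWithinAt γ p (Set.Icc 0 1) k.1) (hδ : HasDerivWithinAt δ q (Set.Icc 0 1) k.2)
    (hk : γ k.1 = δ k.2) {C : ℝ} (hC : ∀ x ∈ Set.Icc (0 : ℝ) 1 ×ˢ Set.Icc (0 : ℝ) 1,
      |x.1 - k.1| ≤ C * ‖meetModel p q k x‖ ∧ |x.2 - k.2| ≤ C * ‖meetModel p q k x‖) :
    Tendsto (fun x : ℝ × ℝ => (γ x.1 - δ x.2) / meetModel p q k x)
      (𝓝[(Set.Icc (0 : ℝ) 1 ×ˢ Set.Icc (0 : ℝ) 1) \ {k}] k) (𝓝 1) := by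
  have hK : ∀ᶠ x in 𝓝[(Set.Icc (0 : ℝ) 1 ×ˢ Set.Icc (0 : ℝ) 1) \ {k}] k,
      x ∈ (Set.Icc (0 : ℝ) 1 ×ˢ Set.Icc (0 : ℝ) 1) \ {k} := eventually_mem_nhdsWithin
  have t1 : Tendsto Prod.fst (𝓝[(Set.Icc (0 : ℝ) 1 ×ˢ Set.Icc (0 : ℝ) 1) \ {k}] k)
      (𝓝[Set.Icc 0 1] k.1) :=
    tendsto_nhdsWithin_iff.2 ⟨continuous_fst.continuousWithinAt.tendsto,
      hK.mono fun x hx => hx.1.1⟩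
  have t2 : Tendsto Prod.snd (𝓝[(Set.Icc (0 : ℝ) 1 ×ˢ Set.Icc (0 : ℝ) 1) \ {k}] k)
      (𝓝[Set.Icc 0 1] k.2) :=
    tendsto_nhdsWithin_iff.2 ⟨continuous_snd.continuousWithinAt.tendsto,
      hK.mono fun x hx => hx.1.2⟩
  have b1 : (fun x : ℝ × ℝ => x.1 - k.1)
      =O[𝓝[(Set.Icc (0 : ℝ) 1 ×ˢ Set.Icc (0 : ℝ) 1) \ {k}] k] meetModel p q k :=
    IsBigO.of_bound C (hK.mono fun x hx => (hC x hx.1).1)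
  have b2 : (fun x : ℝ × ℝ => x.2 - k.2)
      =O[𝓝[(Set.Icc (0 : ℝ) 1 ×ˢ Set.Icc (0 : ℝ) 1) \ {k}] k] meetModel p q k :=
    IsBigO.of_bound C (hK.mono fun x hx => (hC x hx.1).2)
  have o1 := (hγ.isLittleO.comp_tendsto t1).trans_isBigO b1
  have o2 := (hδ.isLittleO.comp_tendsto t2).trans_isBigO b2
  have o := o1.sub o2
  have hne : ∀ᶠ x in 𝓝[(Set.Icc (0 : ℝ) 1 ×ˢ Set.Icc (0 : ℝ) 1) \ {k}] k,
      meetModel p q k x ≠ 0 := by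
    refine hK.mono fun x hx h0 => hx.2 ?_
    obtain ⟨h1, h2⟩ := hC x hx.1
    rw [h0, norm_zero, mul_zero] at h1 h2
    exact Prod.ext (sub_eq_zero.1 (abs_nonpos_iff.1 h1)) (sub_eq_zero.1 (abs_nonpos_iff.1 h2))
  have := (isEquivalent_iff_tendsto_one (u := fun x : ℝ × ℝ => γ x.1 - δ x.2) hne).1 ?_
  · exact this
  · refine o.congr_left fun x => ?_
    simp only [Function.comp, Complex.real_smul, meetModel, Pi.sub_apply]
    rw [hk]
    push_cast
    ring

open Filter Topology in
/-- Dividing a function on the square by models of its finitely many zeros leaves a nonvanishing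
continuous function, so the monodromy is the product of the monodromies of the models. -/
theorem SqrtMon.of_zeros {F : ℝ × ℝ → ℂ} {L : ℝ × ℝ → ℝ × ℝ → ℂ} {m : ℝ × ℝ → ℂ}
    (S : Finset (ℝ × ℝ)) (hF : ContinuousOn F (Set.Icc (0 : ℝ) 1 ×ˢ Set.Icc (0 : ℝ) 1))
    (hS : ∀ x ∈ Set.Icc (0 : ℝ) 1 ×ˢ Set.Icc (0 : ℝ) 1, F x = 0 ↔ x ∈ S)
    (hLc : ∀ k ∈ S, Continuous (L k))
    (hL : ∀ k ∈ S, ∀ x ∈ Set.Icc (0 : ℝ) 1 ×ˢ Set.Icc (0 : ℝ) 1, L k x = 0 ↔ x = k)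
    (hlim : ∀ k ∈ S, Tendsto (fun x => F x / L k x)
      (𝓝[(Set.Icc (0 : ℝ) 1 ×ˢ Set.Icc (0 : ℝ) 1) \ {k}] k) (𝓝 1))
    (hm : ∀ k ∈ S, SqrtMon (L k) (m k)) : SqrtMon F (∏ k ∈ S, m k) := by
  classical
  obtain ⟨K, hK⟩ : ∃ K, K = Set.Icc (0 : ℝ) 1 ×ˢ Set.Icc (0 : ℝ) 1 := ⟨_, rfl⟩
  rw [← hK] at hF hS hL hlim
  -- `G` is `F` divided by all models. At a zero `x` the factor `F / L x` is replaced by its limit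
  -- `1`.
  let G : ℝ × ℝ → ℂ := fun x =>
    if x ∈ S then ∏ k ∈ S.erase x, (L k x)⁻¹ else F x * ∏ k ∈ S, (L k x)⁻¹
  have hLne : ∀ k ∈ S, ∀ x ∈ K, x ≠ k → L k x ≠ 0 := fun k hk x hx h h' => h ((hL k hk x hx).1 h')
  have hcont : ∀ T ⊆ S, ∀ x ∈ K, x ∉ T → ContinuousWithinAt (fun x => ∏ k ∈ T, (L k x)⁻¹) K x := by
    intro T hT x hx hxT
    refine tendsto_finsetProd _ fun k hk => ?_
    exact ((hLc k (hT hk)).continuousWithinAt.inv₀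
      (hLne k (hT hk) x hx (fun h => hxT (h ▸ hk)))).tendsto
  have hG : ContinuousOn G K := by
    intro x hx
    by_cases hxS : x ∈ S
    · have h1 : ContinuousWithinAt (Function.update (fun y => F y / L x y) x 1) K x :=
        continuousWithinAt_update_same.2 (hlim x hxS)
      have h2 := h1.mul (hcont (S.erase x) (Finset.erase_subset _ _) x hx (by simp))
      refine h2.congr_of_eventuallyEq ?_ ?_
      · have : ∀ᶠ y in 𝓝[K] x, y ∉ S.erase x := mem_nhdsWithin_of_mem_nhds
          ((S.erase x).finite_toSet.isClosed.isOpen_compl.mem_nhds (by simp))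
        filter_upwards [this] with y hy
        by_cases hyx : y = x
        · subst hyx
          simp [G, hxS]
        · have hyS : y ∉ S := fun h => hy (Finset.mem_erase.2 ⟨hyx, h⟩)
          simp only [G, if_neg hyS, Pi.mul_apply, Function.update_of_ne hyx]
          rw [← Finset.mul_prod_erase S _ hxS]
          ring
      · simp [G, hxS]
    · refine ((hF x hx).mul (hcont S subset_rfl x hx hxS)).congr_of_eventuallyEq ?_ ?_
      · have : ∀ᶠ y in 𝓝[K] x, y ∉ S := mem_nhdsWithin_of_mem_nhds
          (S.finite_toSet.isClosed.isOpen_compl.mem_nhds (by simpa))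
        filter_upwards [this] with y hy
        simp [G, hy]
      · simp [G, hxS]
  have hG0 : ∀ x ∈ K, G x ≠ 0 := by
    intro x hx
    by_cases hxS : x ∈ S
    · simp only [G, if_pos hxS]
      refine Finset.prod_ne_zero_iff.2 fun k hk => inv_ne_zero ?_
      exact hLne k (Finset.mem_of_mem_erase hk) x hx (Finset.ne_of_mem_erase hk).symm
    · simp only [G, if_neg hxS]
      refine mul_ne_zero (fun h => hxS ((hS x hx).1 h)) (Finset.prod_ne_zero_iff.2 fun k hk =>
        inv_ne_zero (hLne k hk x hx (fun h => hxS (h ▸ hk))))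
  subst hK
  have := (SqrtMon.of_continuousOn hG hG0).mul (SqrtMon.prod S hm)
  rw [one_mul] at this
  refine this.congr fun x hx => ?_
  by_cases hxS : x ∈ S
  · rw [(hS x hx).2 hxS, Finset.prod_eq_zero (f := fun k => L k x) hxS ((hL x hxS x hx).2 rfl),
      mul_zero]
  · simp only [G, if_neg hxS]
    rw [mul_assoc, ← Finset.prod_mul_distrib, Finset.prod_eq_one, mul_one]
    intro k hk
    exact inv_mul_cancel₀ (hLne k hk x hx (fun h => hxS (h ▸ hk)))

theorem endParam_mem (b : Bool) : endParam b ∈ Set.Icc (0 : ℝ) 1 := by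
  cases b <;> simp [endParam]

theorem endParam_notMem_Ioo (b : Bool) : endParam b ∉ Set.Ioo (0 : ℝ) 1 := by
  cases b <;> simp [endParam]

theorem endParam_injective : Function.Injective endParam := by
  intro a b
  cases a <;> cases b <;> simp [endParam]

theorem mem_Ioo_or_eq_endParam {s : ℝ} (hs : s ∈ Set.Icc (0 : ℝ) 1) :
    s ∈ Set.Ioo (0 : ℝ) 1 ∨ ∃ b, s = endParam b := by
  rcases hs.1.eq_or_lt with h | h
  · exact Or.inr ⟨false, by simp [endParam, ← h]⟩
  · rcases hs.2.eq_or_lt with h' | h'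
    · exact Or.inr ⟨true, by simp [endParam, h']⟩
    · exact Or.inl ⟨h, h'⟩

/-! ### The crossing parity of two arcs. -/

/-- `γ` is a regular differentiable arc on `[0,1]` with velocity `γ'`. -/
structure RegularArc (γ γ' : ℝ → ℂ) : Prop where
  hasDeriv : ∀ s ∈ Set.Icc (0 : ℝ) 1, HasDerivWithinAt γ (γ' s) (Set.Icc 0 1) s
  ne_zero : ∀ s ∈ Set.Icc (0 : ℝ) 1, γ' s ≠ 0

/-- The tangent vector at an end of an arc, pointing into the arc. -/
noncomputable def endOut (γ' : ℝ → ℂ) (b : Bool) : ℂ := endSign b * γ' (endParam b)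

theorem RegularArc.endOut_ne_zero {γ γ' : ℝ → ℂ} (hγ : RegularArc γ γ') (b : Bool) :
    endOut γ' b ≠ 0 := by
  refine mul_ne_zero ?_ (hγ.ne_zero _ (endParam_mem b))
  cases b <;> simp [endSign]

-- By `h₁` and `h₂` the difference vanishes on the boundary of the square at corners only. So its
-- zeros are the crossings, each contributing `-1`, and the corners belonging to common end points.
open Classical in
theorem RegularArc.sqrtMon_sub {γ γ' δ δ' : ℝ → ℂ} (hγ : RegularArc γ γ') (hδ : RegularArc δ δ')
    (h₁ : ∀ s ∈ Set.Ioo (0 : ℝ) 1, ∀ j, γ s ≠ δ (endParam j))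
    (h₂ : ∀ t ∈ Set.Ioo (0 : ℝ) 1, ∀ i, γ (endParam i) ≠ δ t)
    (h₃ : ∀ i j, γ (endParam i) = δ (endParam j) → ¬ SameRay ℝ (endOut γ' i) (endOut δ' j))
    (Z : Finset (ℝ × ℝ)) (hZ : ∀ x, x ∈ Z ↔
      x.1 ∈ Set.Ioo (0 : ℝ) 1 ∧ x.2 ∈ Set.Ioo (0 : ℝ) 1 ∧ γ x.1 = δ x.2)
    (h₄ : ∀ x ∈ Z, (conj (γ' x.1) * δ' x.2).im ≠ 0) :
    SqrtMon (fun x => γ x.1 - δ x.2) ((-1) ^ Z.card * ∏ ij : Bool × Bool,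
      if γ (endParam ij.1) = δ (endParam ij.2) then
        (if ij.1 = ij.2 then sqrtDir (-endOut δ' ij.2 / endOut γ' ij.1)
          else (sqrtDir (-endOut δ' ij.2 / endOut γ' ij.1))⁻¹) else 1) := by
  let e : Bool × Bool → ℝ × ℝ := Prod.map endParam endParam
  have he : Function.Injective e := endParam_injective.prodMap endParam_injective
  let C : Finset (Bool × Bool) :=
    Finset.univ.filter fun ij => γ (endParam ij.1) = δ (endParam ij.2)
  let S : Finset (ℝ × ℝ) := Z ∪ C.image e
  let μ : Bool × Bool → ℂ := fun ij =>
    if ij.1 = ij.2 then sqrtDir (-endOut δ' ij.2 / endOut γ' ij.1)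
          else (sqrtDir (-endOut δ' ij.2 / endOut γ' ij.1))⁻¹
  let m : ℝ × ℝ → ℂ := fun x => if x ∈ Z then -1 else μ (Function.invFun e x)
  have hCm : ∀ ij, ij ∈ C ↔ γ (endParam ij.1) = δ (endParam ij.2) := by simp [C]
  have heZ : ∀ ij, e ij ∉ Z := fun ij h => endParam_notMem_Ioo _ ((hZ _).1 h).1
  have hdisj : Disjoint Z (C.image e) := by
    rw [Finset.disjoint_left]
    rintro x hx hx'
    obtain ⟨ij, -, rfl⟩ := Finset.mem_image.1 hx'
    exact heZ _ hx
  have hγc : ContinuousOn γ (Set.Icc 0 1) := fun s hs => (hγ.hasDeriv s hs).continuousWithinAt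
  have hδc : ContinuousOn δ (Set.Icc 0 1) := fun s hs => (hδ.hasDeriv s hs).continuousWithinAt
  have hprod : ∏ k ∈ S, m k = (-1) ^ Z.card * ∏ ij : Bool × Bool,
      if γ (endParam ij.1) = δ (endParam ij.2) then μ ij else 1 := by
    rw [Finset.prod_union hdisj, Finset.prod_image he.injOn]
    congr 1
    · rw [Finset.prod_congr rfl (g := fun _ => (-1 : ℂ)) (fun x hx => by simp [m, hx]),
        Finset.prod_const]
    · rw [Finset.prod_filter]
      refine Finset.prod_congr rfl fun ij _ => ?_
      simp only [m, heZ, if_false, Function.leftInverse_invFun he ij]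
  have hpt : ∀ k ∈ S, k.1 ∈ Set.Icc (0 : ℝ) 1 ∧ k.2 ∈ Set.Icc (0 : ℝ) 1 ∧ γ k.1 = δ k.2 := by
    intro k hk
    rcases Finset.mem_union.1 hk with hk | hk
    · obtain ⟨k1, k2, k3⟩ := (hZ k).1 hk
      exact ⟨Set.Ioo_subset_Icc_self k1, Set.Ioo_subset_Icc_self k2, k3⟩
    · obtain ⟨ij, hij, rfl⟩ := Finset.mem_image.1 hk
      exact ⟨endParam_mem _, endParam_mem _, (hCm ij).1 hij⟩
  have hbd : ∀ k ∈ S, ∃ B : ℝ, ∀ x ∈ Set.Icc (0 : ℝ) 1 ×ˢ Set.Icc (0 : ℝ) 1,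
      |x.1 - k.1| ≤ B * ‖meetModel (γ' k.1) (δ' k.2) k x‖ ∧
      |x.2 - k.2| ≤ B * ‖meetModel (γ' k.1) (δ' k.2) k x‖ := by
    intro k hk
    rcases Finset.mem_union.1 hk with hk | hk
    · have hJ := h₄ k hk
      refine ⟨max (‖δ' k.2‖ / |(conj (γ' k.1) * δ' k.2).im|)
        (‖γ' k.1‖ / |(conj (γ' k.1) * δ' k.2).im|), fun x _ => ?_⟩
      obtain ⟨h1, h2⟩ := abs_le_norm_meetModel hJ k x
      exact ⟨h1.trans (mul_le_mul_of_nonneg_right (le_max_left _ _) (norm_nonneg _)),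
        h2.trans (mul_le_mul_of_nonneg_right (le_max_right _ _) (norm_nonneg _))⟩
    · obtain ⟨ij, hij, rfl⟩ := Finset.mem_image.1 hk
      exact exists_abs_le_norm_meetModel (hγ.ne_zero _ (endParam_mem _)) (h₃ _ _ ((hCm ij).1 hij))
  rw [← hprod]
  refine SqrtMon.of_zeros (L := fun k => meetModel (γ' k.1) (δ' k.2) k) S ?_ ?_ ?_ ?_ ?_ ?_
  · exact (hγc.comp continuousOn_fst fun x hx => hx.1).sub
      (hδc.comp continuousOn_snd fun x hx => hx.2)
  · intro x hx
    rw [sub_eq_zero]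
    refine ⟨fun h => ?_, fun h => (hpt x h).2.2⟩
    rcases mem_Ioo_or_eq_endParam hx.1 with k1 | ⟨i, hi⟩
    · rcases mem_Ioo_or_eq_endParam hx.2 with k2 | ⟨j, hj⟩
      · exact Finset.mem_union_left _ ((hZ x).2 ⟨k1, k2, h⟩)
      · exact (h₁ _ k1 j (by rw [← hj, h])).elim
    · rcases mem_Ioo_or_eq_endParam hx.2 with k2 | ⟨j, hj⟩
      · exact (h₂ _ k2 i (by rw [← hi, h])).elim
      · refine Finset.mem_union_right _ (Finset.mem_image.2 ⟨(i, j), (hCm _).2 ?_, ?_⟩)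
        · rw [← hi, ← hj, h]
        · exact Prod.ext hi.symm hj.symm
  · intro k _
    unfold meetModel
    fun_prop
  · intro k hk x hx
    obtain ⟨B, hB⟩ := hbd k hk
    constructor
    · intro h0
      obtain ⟨h1, h2⟩ := hB x hx
      rw [h0, norm_zero, mul_zero] at h1 h2
      exact Prod.ext (sub_eq_zero.1 (abs_nonpos_iff.1 h1)) (sub_eq_zero.1 (abs_nonpos_iff.1 h2))
    · rintro rfl
      simp [meetModel]
  · intro k hk
    obtain ⟨B, hB⟩ := hbd k hk
    obtain ⟨k1, k2, k3⟩ := hpt k hk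
    exact tendsto_sub_div_meetModel (hγ.hasDeriv _ k1) (hδ.hasDeriv _ k2) k3 hB
  · intro k hk
    rcases Finset.mem_union.1 hk with hk | hk
    · obtain ⟨k1, k2, -⟩ := (hZ k).1 hk
      simp only [m, if_pos hk]
      exact SqrtMon.meetModel_of_mem_Ioo k1 k2 (h₄ k hk)
    · obtain ⟨ij, hij, rfl⟩ := Finset.mem_image.1 hk
      simp only [m, heZ, if_false, Function.leftInverse_invFun he ij]
      exact SqrtMon.meetModel_endParam (hγ.ne_zero _ (endParam_mem _))
        (hδ.ne_zero _ (endParam_mem _)) (h₃ _ _ ((hCm ij).1 hij))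

open Classical in
/-- The direction in which an end of an arc is seen from `p`: if it is `p` itself, the tangent
direction of the arc. -/
noncomputable def endDir (γ γ' : ℝ → ℂ) (b : Bool) (p : ℂ) : ℂ :=
  if γ (endParam b) = p then endOut γ' b else γ (endParam b) - p

-- If an end of the arc is at `p`, dividing by the distance of the parameter from that end removes
-- the zero and leaves the tangent as limit. The value of `η` is never needed, only that it is a
-- sign determined by the arc and the point.
open Filter Topology in
theorem RegularArc.exists_sqrtHol_sub {γ γ' : ℝ → ℂ} (hγ : RegularArc γ γ') (hne : γ 0 ≠ γ 1)
    {p : ℂ} (hp : ∀ s ∈ Set.Ioo (0 : ℝ) 1, γ s ≠ p) :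
    ∃ η : ℂ, η ^ 2 = 1 ∧ SqrtHol (fun s => γ s - p)
      (η * (sqrtDir (endDir γ γ' true p) / sqrtDir (endDir γ γ' false p))) := by
  have hγc : ContinuousOn γ (Set.Icc 0 1) := fun s hs => (hγ.hasDeriv s hs).continuousWithinAt
  suffices h : ∃ ψ : ℝ → ℂ, ContinuousOn ψ (Set.Icc 0 1) ∧ (∀ s ∈ Set.Icc (0 : ℝ) 1, ψ s ≠ 0) ∧
      (∀ s ∈ Set.Ioo (0 : ℝ) 1, ∃ ρ : ℝ, 0 < ρ ∧ γ s - p = ρ * ψ s) ∧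
      ψ 1 = endDir γ γ' true p ∧ ψ 0 = endDir γ γ' false p by
    obtain ⟨ψ, hc, h0, h, e1, e0⟩ := h
    obtain ⟨ζ, hζ, hζ'⟩ := SqrtHol.exists_of_continuousOn hc h0 h
    rw [e1, e0] at hζ'
    rcases hζ' with rfl | rfl
    · exact ⟨1, by norm_num, by rwa [one_mul]⟩
    · exact ⟨-1, by norm_num, by rwa [neg_one_mul]⟩
  by_cases h : ∃ b, γ (endParam b) = p
  · obtain ⟨b, rfl⟩ := h
    have hb : ∀ s ∈ Set.Icc (0 : ℝ) 1, s ≠ endParam b → γ s ≠ γ (endParam b) := by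
      intro s hs hsb
      rcases mem_Ioo_or_eq_endParam hs with h | ⟨c, rfl⟩
      · exact hp s h
      · intro h
        cases b <;> cases c <;> simp_all [endParam]
    have hsgn : (endSign b : ℂ) ≠ 0 := by cases b <;> simp [endSign]
    have hval : ∀ s, s ≠ endParam b → γ s - γ (endParam b) =
        ((s - endParam b : ℝ) : ℂ) * slope γ (endParam b) s := by
      intro s hs
      rw [← Complex.real_smul, sub_smul_slope, vsub_eq_sub]
    -- The sign turns the difference of parameters into its absolute value, so that the factor split
    -- off is positive at either end.
    refine ⟨fun s => endSign b * Function.update (slope γ (endParam b)) (endParam b)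
      (γ' (endParam b)) s, continuousOn_const.mul ?_, ?_, ?_, ?_, ?_⟩
    · intro s hs
      by_cases hsb : s = endParam b
      · subst hsb
        exact continuousWithinAt_update_same.2
          (hasDerivWithinAt_iff_tendsto_slope.1 (hγ.hasDeriv _ hs))
      · rw [continuousWithinAt_update_of_ne hsb]
        have h1 : ContinuousWithinAt (fun s => (s - endParam b)⁻¹ • (γ s - γ (endParam b)))
            (Set.Icc 0 1) s :=
          ((continuousWithinAt_id.sub continuousWithinAt_const).inv₀ (sub_ne_zero.2 hsb)).smul
            ((hγc s hs).sub continuousWithinAt_const)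
        exact h1
    · intro s hs
      refine mul_ne_zero hsgn ?_
      by_cases hsb : s = endParam b
      · subst hsb
        simpa using hγ.ne_zero _ hs
      · rw [Function.update_of_ne hsb]
        intro h0
        have := hval s hsb
        rw [h0, mul_zero, sub_eq_zero] at this
        exact hb s hs hsb this
    · intro s hs
      have hsb : s ≠ endParam b := fun h => endParam_notMem_Ioo b (h ▸ hs)
      refine ⟨|s - endParam b|, abs_pos.2 (sub_ne_zero.2 hsb), ?_⟩
      simp only [Function.update_of_ne hsb]
      rw [hval s hsb,
        ← endSign_mul_sub b (Set.Ioo_subset_Icc_self hs)]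
      have : (endSign b : ℂ) * endSign b = 1 := by exact_mod_cast endSign_mul_self b
      push_cast
      linear_combination (-(s - endParam b) * slope γ (endParam b) s) * this
    · cases b
      · simp [endDir, endParam, endSign, hne.symm, slope]
      · simp [endDir, endParam, endSign, endOut]
    · cases b
      · simp [endDir, endParam, endSign, endOut]
      · simp [endDir, endParam, endSign, hne, slope]
  · push Not at h
    refine ⟨fun s => γ s - p, hγc.sub continuousOn_const, ?_, fun s _ => ⟨1, one_pos, by simp⟩,
      ?_, ?_⟩
    · intro s hs
      rw [sub_ne_zero]
      rcases mem_Ioo_or_eq_endParam hs with h' | ⟨b, rfl⟩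
      · exact hp s h'
      · exact h b
    · have := h true
      simp_all [endDir, endParam]
    · have := h false
      simp_all [endDir, endParam]

theorem sqrtDir_sq (z : ℂ) (hz : z ≠ 0) : sqrtDir z ^ 2 = z / ‖z‖ := by
  have h : (‖z‖ : ℂ) ≠ 0 := by exact_mod_cast norm_ne_zero_iff.2 hz
  rw [eq_div_iff h, mul_comm, norm_mul_sqrtDir_sq]

/-- The fourth root of unity attached to a pair of ends of arcs, at the points `p`, `q` and with
tangents `x`, `y` there. -/
noncomputable def endTurn (p x q y : ℂ) : ℂ :=
  open Classical in
  if p = q then sqrtDir y / sqrtDir x * sqrtDir (-x / y) else sqrtDir (q - p) / sqrtDir (p - q)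

/-- In either case the turn connects opposite directions, in the first one by way of the tangents.
It can therefore be traded for minus its inverse. -/
theorem endTurn_sq {p x q y : ℂ} (hx : x ≠ 0) (hy : y ≠ 0) : endTurn p x q y ^ 2 = -1 := by
  unfold endTurn
  have nx : (‖x‖ : ℂ) ≠ 0 := by exact_mod_cast norm_ne_zero_iff.2 hx
  have ny : (‖y‖ : ℂ) ≠ 0 := by exact_mod_cast norm_ne_zero_iff.2 hy
  split_ifs with h
  · rw [mul_pow, div_pow, sqrtDir_sq x hx, sqrtDir_sq y hy,
      sqrtDir_sq _ (div_ne_zero (neg_ne_zero.2 hx) hy), norm_div, norm_neg]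
    push_cast
    field_simp
  · have h1 : q - p ≠ 0 := sub_ne_zero.2 (Ne.symm h)
    have h2 : p - q ≠ 0 := sub_ne_zero.2 h
    have n1 : (‖p - q‖ : ℂ) ≠ 0 := by exact_mod_cast norm_ne_zero_iff.2 h2
    rw [div_pow, sqrtDir_sq _ h1, sqrtDir_sq _ h2, norm_sub_rev q p]
    field_simp
    ring

/-- For distinct points the tangents play no role, and exchanging the points inverts the turn. This
cancels the contributions of distinct vertices. -/
theorem endTurn_mul_swap {p x q y x' y' : ℂ} (h : p ≠ q) :
    endTurn p x q y * endTurn q x' p y' = 1 := by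
  have h1 := sqrtDir_ne_zero (q - p)
  have h2 := sqrtDir_ne_zero (p - q)
  rw [endTurn, endTurn, if_neg h, if_neg h.symm]
  field_simp

open Classical in
/-- The parity of the number of crossings of two arcs in terms of their ends. -/
theorem RegularArc.neg_one_pow_card {γ γ' δ δ' : ℝ → ℂ} (hγ : RegularArc γ γ')
    (hδ : RegularArc δ δ')
    (h₁ : ∀ s ∈ Set.Ioo (0 : ℝ) 1, ∀ j, γ s ≠ δ (endParam j))
    (h₂ : ∀ t ∈ Set.Ioo (0 : ℝ) 1, ∀ i, γ (endParam i) ≠ δ t)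
    (h₃ : ∀ i j, γ (endParam i) = δ (endParam j) → ¬ SameRay ℝ (endOut γ' i) (endOut δ' j))
    (Z : Finset (ℝ × ℝ)) (hZ : ∀ x, x ∈ Z ↔
      x.1 ∈ Set.Ioo (0 : ℝ) 1 ∧ x.2 ∈ Set.Ioo (0 : ℝ) 1 ∧ γ x.1 = δ x.2)
    (h₄ : ∀ x ∈ Z, (conj (γ' x.1) * δ' x.2).im ≠ 0) {η θ : Bool → ℂ}
    (hη : ∀ j, η j ^ 2 = 1) (hθ : ∀ i, θ i ^ 2 = 1)
    (hη' : ∀ j, SqrtHol (fun s => γ s - δ (endParam j))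
      (η j * (sqrtDir (endDir γ γ' true (δ (endParam j))) /
        sqrtDir (endDir γ γ' false (δ (endParam j))))))
    (hθ' : ∀ i, SqrtHol (fun t => δ t - γ (endParam i))
      (θ i * (sqrtDir (endDir δ δ' true (γ (endParam i))) /
        sqrtDir (endDir δ δ' false (γ (endParam i)))))) :
    (-1 : ℂ) ^ Z.card = (∏ j, η j) * (∏ i, θ i) * ∏ i, ∏ j,
      endTurn (γ (endParam i)) (endOut γ' i) (δ (endParam j)) (endOut δ' j) := by
  have hM := hγ.sqrtMon_sub hδ h₁ h₂ h₃ Z hZ h₄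
  -- On the left and right sides the difference is the negative of the function in `hθ'`; a constant
  -- factor does not affect holonomy.
  have hM' : SqrtMon (fun x => γ x.1 - δ x.2) _ := ⟨_, _, _, _, hη' false,
    ((hθ' true).const_mul (neg_ne_zero.2 one_ne_zero)).congr (fun s _ => ?_), hη' true,
    ((hθ' false).const_mul (neg_ne_zero.2 one_ne_zero)).congr (fun s _ => ?_), rfl⟩
  rotate_left
  · simp [endParam]
  · simp [endParam]
  have key := hM.unique hM'
  let κ : Bool → Bool → ℂ := fun i j =>
    if γ (endParam i) = δ (endParam j) then sqrtDir (-endOut γ' i / endOut δ' j) else 1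
  let R : Bool → Bool → ℂ := fun i j => sqrtDir (endDir γ γ' i (δ (endParam j)))
  let T : Bool → Bool → ℂ := fun i j => sqrtDir (endDir δ δ' j (γ (endParam i)))
  let Q : Bool → Bool → ℂ := fun i j =>
    endTurn (γ (endParam i)) (endOut γ' i) (δ (endParam j)) (endOut δ' j)
  have hκ : ∀ i j, κ i j ≠ 0 := by
    intro i j
    simp only [κ]
    split_ifs
    exacts [sqrtDir_ne_zero _, one_ne_zero]
  have hR : ∀ i j, R i j ≠ 0 := fun i j => sqrtDir_ne_zero _
  have hT : ∀ i j, T i j ≠ 0 := fun i j => sqrtDir_ne_zero _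
  have hQ : ∀ i j, Q i j = T i j / R i j * κ i j := by
    intro i j
    simp only [Q, T, R, κ, endTurn, endDir]
    by_cases h : γ (endParam i) = δ (endParam j)
    · simp [h]
    · simp [h, Ne.symm h]
  have hQ2 : ∀ i j, Q i j ^ 2 = -1 := fun i j =>
    endTurn_sq (hγ.endOut_ne_zero i) (hδ.endOut_ne_zero j)
  have hQ0 : ∀ i j, Q i j ≠ 0 := fun i j => by
    rw [hQ]
    exact mul_ne_zero (div_ne_zero (hT _ _) (hR _ _)) (hκ _ _)
  have hC : ∀ i j, (if γ (endParam i) = δ (endParam j) then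
        (if i = j then sqrtDir (-endOut δ' j / endOut γ' i)
          else (sqrtDir (-endOut δ' j / endOut γ' i))⁻¹) else 1) =
      if i = j then (κ i j)⁻¹ else κ i j := by
    intro i j
    by_cases h : γ (endParam i) = δ (endParam j)
    · have hs := neg_div_mem_slitPlane (hγ.endOut_ne_zero i) (h₃ i j h)
      have hinv : -endOut γ' i / endOut δ' j = (-endOut δ' j / endOut γ' i)⁻¹ := by
        rw [inv_div, div_neg, neg_div]
      simp only [κ, h, if_true, hinv, sqrtDir_inv hs, inv_inv]
    · simp [κ, h]
  rw [Fintype.prod_prod_type] at key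
  simp only [hC, Fintype.prod_bool, if_true, Bool.false_eq_true, if_false, reduceCtorEq] at key
  simp only [Fintype.prod_bool]
  change _ = η true * η false * (θ true * θ false) *
    (Q true true * Q true false * (Q false true * Q false false))
  change _ = η false * (R true false / R false false) * (θ true * (T true true / T true false)) /
    (η true * (R true true / R false true) * (θ false * (T false true / T false false))) at key
  -- In the monodromy the two corners with `i ≠ j` enter inversely to the other two. Replacing `Q`
  -- by `-Q⁻¹` at both makes all four alike, and the two signs cancel.
  have q1 : Q true false = -(Q true false)⁻¹ := by
    have := hQ2 true false
    have h0 := hQ0 true false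
    field_simp
    exact this
  have q2 : Q false true = -(Q false true)⁻¹ := by
    have := hQ2 false true
    have h0 := hQ0 false true
    field_simp
    exact this
  have e1 : η true = (η true)⁻¹ := eq_inv_of_mul_eq_one_left (by rw [← sq, hη])
  have e2 : θ false = (θ false)⁻¹ := eq_inv_of_mul_eq_one_left (by rw [← sq, hθ])
  rw [q1, q2, e1, e2, hQ, hQ, hQ, hQ]
  have k1 := hκ true true
  have k2 := hκ true false
  have k3 := hκ false true
  have k4 := hκ false false
  have key := eq_div_of_mul_eq (by simp [k1, k2, k3, k4]) key
  rw [key]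
  have r1 := hR true true
  have r2 := hR true false
  have r3 := hR false true
  have r4 := hR false false
  have t1 := hT true true
  have t2 := hT true false
  have t3 := hT false true
  have t4 := hT false false
  have n1 : η true ≠ 0 := fun h => by simpa [h] using hη true
  have n2 : θ false ≠ 0 := fun h => by simpa [h] using hθ false
  field_simp

/-! ### The turning around a vertex. -/

theorem re_sqrtDir_pos {z : ℂ} (hz : z ∈ Complex.slitPlane) : 0 < (sqrtDir z).re := by
  have h : (sqrtDir z).re = Real.cos (z.arg / 2) := by
    rw [sqrtDir, mul_comm, Complex.exp_ofReal_mul_I_re]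
  rw [h]
  have h1 := Complex.neg_pi_lt_arg z
  have h2 := lt_of_le_of_ne (Complex.arg_le_pi z) (Complex.mem_slitPlane_iff_arg.1 hz).1
  exact Real.cos_pos_of_mem_Ioo ⟨by linarith, by linarith⟩

theorem sq_re_add_sq_im_eq_one {z : ℂ} (hz : ‖z‖ = 1) : z.re ^ 2 + z.im ^ 2 = 1 := by
  have h := Complex.normSq_eq_norm_sq z
  rw [hz, Complex.normSq_apply] at h
  linarith

/-- The three roots `A`, `B`, `C` have positive real parts, and `(A * B * C) ^ 2 = -1`, so their
product is `s * I` with `s = ±1`. The signed area defining `Clockwise` is the sum of the imaginary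
parts of their squares, which equals `4 * s * (A.re * B.re * C.re)`. It is negative, so `s = -1`. -/
theorem sqrtDir_mul_of_clockwise {a b c : ℂ} (ha : a ≠ 0) (hb : b ≠ 0) (hc : c ≠ 0)
    (hab : ¬ SameRay ℝ a b) (hbc : ¬ SameRay ℝ b c) (hca : ¬ SameRay ℝ c a)
    (h : Clockwise a b c) :
    sqrtDir (-a / b) * sqrtDir (-b / c) * sqrtDir (-c / a) = -Complex.I := by
  have na : (‖a‖ : ℂ) ≠ 0 := by exact_mod_cast norm_ne_zero_iff.2 ha
  have nb : (‖b‖ : ℂ) ≠ 0 := by exact_mod_cast norm_ne_zero_iff.2 hb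
  have nc : (‖c‖ : ℂ) ≠ 0 := by exact_mod_cast norm_ne_zero_iff.2 hc
  have pA := re_sqrtDir_pos (neg_div_mem_slitPlane hb fun h => hab h.symm)
  have pB := re_sqrtDir_pos (neg_div_mem_slitPlane hc fun h => hbc h.symm)
  have pC := re_sqrtDir_pos (neg_div_mem_slitPlane ha fun h => hca h.symm)
  have uA := norm_sqrtDir (-a / b)
  have uB := norm_sqrtDir (-b / c)
  have sA : sqrtDir (-a / b) ^ 2 = -(a / ‖a‖) / (b / ‖b‖) := by
    rw [sqrtDir_sq _ (div_ne_zero (neg_ne_zero.2 ha) hb), norm_div, norm_neg]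
    push_cast
    field_simp
  have sB : sqrtDir (-b / c) ^ 2 = -(b / ‖b‖) / (c / ‖c‖) := by
    rw [sqrtDir_sq _ (div_ne_zero (neg_ne_zero.2 hb) hc), norm_div, norm_neg]
    push_cast
    field_simp
  have sC : sqrtDir (-c / a) ^ 2 = -(c / ‖c‖) / (a / ‖a‖) := by
    rw [sqrtDir_sq _ (div_ne_zero (neg_ne_zero.2 hc) ha), norm_div, norm_neg]
    push_cast
    field_simp
  have unit : ∀ z : ℂ, z ≠ 0 → ‖z / ‖z‖‖ = 1 := by
    intro z hz
    rw [norm_div, Complex.norm_real, norm_norm, div_self (norm_ne_zero_iff.2 hz)]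
  have u1 := unit a ha
  have u2 := unit b hb
  have u3 := unit c hc
  unfold Clockwise at h
  generalize a / (‖a‖ : ℂ) = x at *
  generalize b / (‖b‖ : ℂ) = y at *
  generalize c / (‖c‖ : ℂ) = z at *
  generalize sqrtDir (-a / b) = A at *
  generalize sqrtDir (-b / c) = B at *
  generalize sqrtDir (-c / a) = C at *
  have x0 : x ≠ 0 := by rintro rfl; simp at u1
  have y0 : y ≠ 0 := by rintro rfl; simp at u2
  have z0 : z ≠ 0 := by rintro rfl; simp at u3
  have inv : ∀ w : ℂ, ‖w‖ = 1 → w⁻¹ = conj w := by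
    intro w hw
    rw [Complex.inv_def, Complex.normSq_eq_norm_sq, hw]
    simp
  have hsq : (A * B * C) ^ 2 = Complex.I ^ 2 := by
    rw [mul_pow, mul_pow, sA, sB, sC, Complex.I_sq]
    field_simp
  have area : (conj (y - x) * (z - x)).im = (A ^ 2).im + (B ^ 2).im + (C ^ 2).im := by
    rw [sA, sB, sC, div_eq_mul_inv, div_eq_mul_inv, div_eq_mul_inv, inv x u1, inv y u2, inv z u3]
    simp only [map_sub, Complex.mul_im, Complex.sub_re, Complex.sub_im, Complex.conj_re,
      Complex.conj_im, Complex.neg_re, Complex.neg_im]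
    ring
  rw [area] at h
  have ident : ∀ s : ℝ, s ^ 2 = 1 → A * B * C = s * Complex.I →
      (A ^ 2).im + (B ^ 2).im + (C ^ 2).im = 4 * s * (A.re * B.re * C.re) := by
    intro s hs hABC
    have hC : C = s * Complex.I * (conj A * conj B) := by
      have hA0 : A ≠ 0 := by rintro rfl; simp at uA
      have hB0 : B ≠ 0 := by rintro rfl; simp at uB
      rw [← inv A uA, ← inv B uB, ← hABC]
      field_simp
    have hA := sq_re_add_sq_im_eq_one uA
    have hB := sq_re_add_sq_im_eq_one uB
    have c1 : C.re = s * (A.re * B.im + A.im * B.re) := by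
      rw [hC]
      simp only [Complex.mul_re, Complex.mul_im, Complex.ofReal_re, Complex.ofReal_im,
        Complex.I_re, Complex.I_im, Complex.conj_re, Complex.conj_im]
      ring
    have c2 : C.im = s * (A.re * B.re - A.im * B.im) := by
      rw [hC]
      simp only [Complex.mul_re, Complex.mul_im, Complex.ofReal_re, Complex.ofReal_im,
        Complex.I_re, Complex.I_im, Complex.conj_re, Complex.conj_im]
      ring
    simp only [sq, Complex.mul_im]
    rw [c1, c2]
    have e : s * (A.re * B.im + A.im * B.re) * (s * (A.re * B.re - A.im * B.im)) =
        (A.re * B.im + A.im * B.re) * (A.re * B.re - A.im * B.im) := by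
      linear_combination (A.re * B.im + A.im * B.re) * (A.re * B.re - A.im * B.im) * hs
    have e' : 4 * s * (A.re * B.re * (s * (A.re * B.im + A.im * B.re))) =
        4 * (A.re * B.re * (A.re * B.im + A.im * B.re)) := by
      linear_combination 4 * (A.re * B.re * (A.re * B.im + A.im * B.re)) * hs
    rw [e', e, mul_comm (s * (A.re * B.re - A.im * B.im)), e]
    linear_combination (-2) * (B.re * B.im) * hA - 2 * (A.re * A.im) * hB
  rcases sq_eq_sq_iff_eq_or_eq_neg.1 hsq with h' | h'
  · have := ident 1 (by norm_num) (by simpa using h')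
    have hp := mul_pos (mul_pos pA pB) pC
    linarith
  · exact h'

/-! ### The cyclic order of colours and the cancellation over edge ends. -/

namespace Color

/-- The cyclic order `r, b, p` of the colours. -/
def next : Color → Color
  | .r => .b
  | .b => .p
  | .p => .r

theorem next_injective : Function.Injective next := by
  intro x y
  cases x <;> cases y <;> simp [next]

theorem next_ne (x : Color) : next x ≠ x := by cases x <;> simp [next]

theorem next_next_ne (x : Color) : next (next x) ≠ x := by cases x <;> simp [next]

theorem eq_next_or (x y : Color) (h : x ≠ y) : y = next x ∨ x = next y := by
  revert h; cases x <;> cases y <;> simp [next]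

theorem prod_eq {M : Type*} [CommMonoid M] (f : Color → M) : ∏ x, f x = f .r * f .b * f .p := by
  have : (Finset.univ : Finset Color) = {.r, .b, .p} := rfl
  rw [this, Finset.prod_insert (by decide), Finset.prod_insert (by decide), Finset.prod_singleton,
    mul_assoc]

theorem next_bijective : Function.Bijective next := Finite.injective_iff_bijective.1 next_injective

end Color

/-- If the clockwise order of the colours is even, the turns multiply to `-I` and the tensor is `I`.
If it is odd, the turns run counterclockwise and both factors are inverted. -/
theorem nodeTensor_mul_prod_sqrtDir {i j k : Color} (hij : i ≠ j) (hik : i ≠ k) (hjk : j ≠ k)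
    {d : Color → ℂ} (hd : ∀ x, d x ≠ 0) (hr : ∀ x y, x ≠ y → ¬ SameRay ℝ (d x) (d y))
    (h : Clockwise (d i) (d j) (d k)) :
    nodeTensor i j k * ∏ x : Color, sqrtDir (-d x / d x.next) = 1 := by
  have h1 := sqrtDir_mul_of_clockwise (hd i) (hd j) (hd k) (hr _ _ hij) (hr _ _ hjk)
    (hr _ _ hik.symm) h
  have hinv : ∀ x y, x ≠ y → sqrtDir (-d x / d y) = (sqrtDir (-d y / d x))⁻¹ := by
    intro x y hxy
    have hs := neg_div_mem_slitPlane (hd x) (hr x y hxy)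
    rw [← sqrtDir_inv hs, inv_div, div_neg, neg_div]
  have h2 : sqrtDir (-d j / d i) * sqrtDir (-d k / d j) * sqrtDir (-d i / d k) = Complex.I := by
    rw [hinv j i hij.symm, hinv k j hjk.symm, hinv i k hik, ← mul_inv, ← mul_inv, h1, inv_neg,
      Complex.inv_I, neg_neg]
  rw [Color.prod_eq]
  cases i <;> cases j <;> cases k <;> simp only [ne_eq, not_true, reduceCtorEq,
    not_false_eq_true] at hij hik hjk <;>
    simp only [nodeTensor, epsilonTensor, Color.next]
  · linear_combination Complex.I * h1 - Complex.I_sq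
  · linear_combination -Complex.I * h2 - Complex.I_sq
  · linear_combination -Complex.I * h2 - Complex.I_sq
  · linear_combination Complex.I * h1 - Complex.I_sq
  · linear_combination Complex.I * h1 - Complex.I_sq
  · linear_combination -Complex.I * h2 - Complex.I_sq

/-- Products over the edge ends of a cubic graph with a proper colouring, reorganized by vertices:
contributions that occur twice or in inverse pairs cancel. -/
theorem prod_next_eq_prod_vertex {E V : Type*} [Fintype E] [Fintype V] [DecidableEq V]
    (c : E → Color) (φ : E × Bool ≃ V × Color) (hφ : ∀ h, (φ h).2 = c h.1) (η : E → V → ℂ)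
    (hη : ∀ e v, η e v ^ 2 = 1) (τ : E × Bool → E × Bool → ℂ)
    (hτ : ∀ v w x y, v ≠ w → τ (φ.symm (v, x)) (φ.symm (w, y)) *
      τ (φ.symm (w, x)) (φ.symm (v, y)) = 1) :
    (∏ e, ∏ e', if c e' = (c e).next then (∏ j, η e (φ (e', j)).1) * (∏ i, η e' (φ (e, i)).1) *
      ∏ i, ∏ j, τ (e, i) (e', j) else 1) =
    ∏ v, ∏ x : Color, τ (φ.symm (v, x)) (φ.symm (v, x.next)) := by
  have reindex : ∀ (f : E × Bool → ℂ), ∏ e, ∏ i, f (e, i) = ∏ v, ∏ x, f (φ.symm (v, x)) := by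
    intro f
    rw [← Fintype.prod_prod_type', ← Fintype.prod_prod_type' (f := fun v x => f (φ.symm (v, x)))]
    exact Fintype.prod_equiv φ _ _ (by simp)
  have hcol : ∀ v x, c (φ.symm (v, x)).1 = x := fun v x => by rw [← hφ]; simp
  -- Each vertex carries exactly one end of colour `x`, so the ends of the edges of colour `x` run
  -- once through all vertices.
  have one : ∀ (x : Color) (f : V → ℂ),
      (∏ e, if c e = x then ∏ i, f (φ (e, i)).1 else 1) = ∏ v, f v := by
    intro x f
    have : ∀ e, (if c e = x then ∏ i, f (φ (e, i)).1 else 1) =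
        ∏ i, (if c (e, i).1 = x then f (φ (e, i)).1 else 1) := by
      intro e
      by_cases h : c e = x <;> simp [h]
    simp_rw [this]
    rw [reindex (fun h => if c h.1 = x then f (φ h).1 else 1)]
    simp [hcol]
  have split : ∀ e e', (if c e' = (c e).next then (∏ j, η e (φ (e', j)).1) *
      (∏ i, η e' (φ (e, i)).1) * ∏ i, ∏ j, τ (e, i) (e', j) else 1) =
      (if c e' = (c e).next then ∏ j, η e (φ (e', j)).1 else 1) *
      (if c e' = (c e).next then ∏ i, η e' (φ (e, i)).1 else 1) *
      ∏ i, ∏ j, (if c (e', j).1 = (c (e, i).1).next then τ (e, i) (e', j) else 1) := by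
    intro e e'
    by_cases h : c e' = (c e).next <;> simp [h]
  simp_rw [split, Finset.prod_mul_distrib]
  -- Each sign `η e v` arises once from the edges of the colour after that of `e` and once from
  -- those of the colour before it; the two occurrences cancel.
  have first : (∏ e, ∏ e', if c e' = (c e).next then ∏ j, η e (φ (e', j)).1 else 1) =
      ∏ e, ∏ v, η e v := Finset.prod_congr rfl fun e _ => one _ (η e)
  have second : (∏ e, ∏ e', if c e' = (c e).next then ∏ i, η e' (φ (e, i)).1 else 1) =
      ∏ e, ∏ v, η e v := by
    rw [Finset.prod_comm]
    refine Finset.prod_congr rfl fun e' _ => ?_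
    obtain ⟨x, hx⟩ := Color.next_bijective.2 (c e')
    rw [← one x (η e')]
    refine Finset.prod_congr rfl fun e _ => ?_
    simp only [← hx, Color.next_injective.eq_iff, eq_comm]
  rw [first, second, ← Finset.prod_mul_distrib]
  simp_rw [← Finset.prod_mul_distrib, ← sq, hη, Finset.prod_const_one, one_mul]
  have third : (∏ e, ∏ e', ∏ i, ∏ j,
      (if c (e', j).1 = (c (e, i).1).next then τ (e, i) (e', j) else 1)) =
      ∏ x : Color, ∏ v, ∏ w, τ (φ.symm (v, x)) (φ.symm (w, x.next)) := by
    have h1 : ∀ e, (∏ e', ∏ i, ∏ j,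
        (if c (e', j).1 = (c (e, i).1).next then τ (e, i) (e', j) else 1)) =
        ∏ i, ∏ w, τ (e, i) (φ.symm (w, (c (e, i).1).next)) := by
      intro e
      rw [Finset.prod_comm]
      refine Finset.prod_congr rfl fun i _ => ?_
      rw [reindex (fun h' => if c h'.1 = (c (e, i).1).next then τ (e, i) h' else 1)]
      refine Finset.prod_congr rfl fun w _ => ?_
      simp [hcol]
    simp_rw [h1]
    rw [reindex (fun h => ∏ w, τ h (φ.symm (w, (c h.1).next))), Finset.prod_comm]
    simp_rw [hcol]
  rw [third, Finset.prod_comm (s := (Finset.univ : Finset V))]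
  refine Finset.prod_congr rfl fun x _ => ?_
  rw [← Fintype.prod_prod_type' (f := fun v w => τ (φ.symm (v, x)) (φ.symm (w, x.next))),
    ← Finset.prod_filter_mul_prod_filter_not _ (fun vw : V × V => vw.1 = vw.2)]
  -- The pairs `(v, w)` and `(w, v)` have inverse factors.
  have off : ∏ vw ∈ Finset.univ.filter (fun vw : V × V => ¬ vw.1 = vw.2),
      τ (φ.symm (vw.1, x)) (φ.symm (vw.2, x.next)) = 1 := by
    refine Finset.prod_involution (fun vw _ => vw.swap) ?_ ?_ ?_ ?_
    · intro vw hvw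
      exact hτ _ _ _ _ (Finset.mem_filter.1 hvw).2
    · intro vw hvw _ h
      exact (Finset.mem_filter.1 hvw).2 (congrArg Prod.snd h)
    · intro vw hvw
      simpa [eq_comm] using hvw
    · simp
  rw [off, mul_one]
  refine (Finset.prod_nbij (fun v => (v, v)) ?_ ?_ ?_ ?_).symm
  · simp
  · intro v _ w _ h
    exact congrArg Prod.fst h
  · rintro ⟨v, w⟩ h
    have : v = w := by simpa using h
    subst this
    simp
  · simp

/-! ### Immersed graphs: edge ends, meetings and crossings. -/

namespace PlaneDrawing

variable {α β : Type*} {G : Graph α β} {Γ : PlaneDrawing G}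

theorem base_eq (h : E(G) × Bool) : Γ.base h = Γ.curve h.1 (endParam h.2) := rfl

theorem out_eq (h : E(G) × Bool) : Γ.out h = endOut (Γ.velocity h.1) h.2 := by
  obtain ⟨e, b⟩ := h
  cases b <;> simp [out, endOut, endSign, endParam]

theorem IsImmersion.regularArc (hΓ : Γ.IsImmersion) (e : E(G)) :
    RegularArc (Γ.curve e) (Γ.velocity e) where
  hasDeriv s hs := ((hΓ.contDiffOn e).differentiableOn one_ne_zero s hs).hasDerivWithinAt
  ne_zero := hΓ.velocity_ne_zero e

theorem IsImmersion.out_ne_zero (hΓ : Γ.IsImmersion) (h : E(G) × Bool) : Γ.out h ≠ 0 := by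
  rw [out_eq]
  exact (hΓ.regularArc h.1).endOut_ne_zero h.2

theorem IsImmersion.exists_base_eq (hΓ : Γ.IsImmersion) (h : E(G) × Bool) :
    ∃ v, Γ.base h = Γ.pos v := by
  obtain ⟨x, y, -, h0, h1⟩ := hΓ.ends h.1
  obtain ⟨e, b⟩ := h
  cases b
  · exact ⟨x, by simpa [base] using h0⟩
  · exact ⟨y, by simpa [base] using h1⟩

theorem IsImmersion.inc_iff (hΓ : Γ.IsImmersion) (e : E(G)) (v : V(G)) :
    G.Inc e v ↔ ∃ b, Γ.base (e, b) = Γ.pos v := by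
  obtain ⟨x, y, hl, h0, h1⟩ := hΓ.ends e
  constructor
  · intro h
    rcases h.eq_or_eq_of_isLink hl with h | h
    · exact ⟨false, by simp [base, h0, Subtype.ext h]⟩
    · exact ⟨true, by simp [base, h1, Subtype.ext h]⟩
  · rintro ⟨b, hb⟩
    cases b
    · have : x = v := hΓ.pos_injective (by rw [← h0, ← hb]; simp [base])
      exact this ▸ hl.inc_left
    · have : y = v := hΓ.pos_injective (by rw [← h1, ← hb]; simp [base])
      exact this ▸ hl.inc_right

section Legs

variable (hΓ : Γ.IsImmersion) (hG : IsCubicGraph G)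

theorem IsImmersion.base_eq_pos_iff (h : E(G) × Bool) (v : V(G)) :
    Γ.base h = Γ.pos v ↔ ∃ l, hΓ.legs hG v l = h :=
  Set.ext_iff.1 (hΓ.exists_legs hG v).choose_spec.1 h

theorem IsImmersion.base_legs (v : V(G)) (l : Fin 3) : Γ.base (hΓ.legs hG v l) = Γ.pos v :=
  (hΓ.base_eq_pos_iff hG _ _).2 ⟨l, rfl⟩

theorem IsImmersion.clockwise_legs (v : V(G)) : Clockwise (Γ.out (hΓ.legs hG v 0))
    (Γ.out (hΓ.legs hG v 1)) (Γ.out (hΓ.legs hG v 2)) :=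
  (hΓ.exists_legs hG v).choose_spec.2.2

theorem IsImmersion.isProperEdgeColoring_iff (c : E(G) → Color) :
    IsProperEdgeColoring G c ↔
      ∀ v, Function.Surjective fun l => c (hΓ.legs hG v l).1 := by
  constructor
  · intro h v κ
    obtain ⟨e, he, rfl⟩ := h v v.2 κ
    obtain ⟨b, hb⟩ := (hΓ.inc_iff e v).1 he
    obtain ⟨l, hl⟩ := (hΓ.base_eq_pos_iff hG _ _).1 hb
    exact ⟨l, by simp [hl]⟩
  · intro h v hv κ
    obtain ⟨l, rfl⟩ := h ⟨v, hv⟩ κ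
    exact ⟨_, (hΓ.inc_iff _ ⟨v, hv⟩).2 ⟨_, hΓ.base_legs hG ⟨v, hv⟩ l⟩, rfl⟩

end Legs

theorem injective_of_surjective_color {f : Fin 3 → Color} (hf : Function.Surjective f) :
    Function.Injective f :=
  ((Fintype.bijective_iff_surjective_and_card f).2 ⟨hf, rfl⟩).1

theorem surjective_of_ne {f : Fin 3 → Color} (h01 : f 0 ≠ f 1) (h02 : f 0 ≠ f 2)
    (h12 : f 1 ≠ f 2) : Function.Surjective f := by
  refine ((Fintype.bijective_iff_injective_and_card f).2 ⟨?_, rfl⟩).2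
  intro l l' h
  fin_cases l <;> fin_cases l' <;>
    first | rfl | exact absurd h ‹_› | exact absurd h.symm ‹_›

/-- In a properly coloured immersed cubic graph an edge end is determined by its vertex and its
colour. -/
theorem IsImmersion.exists_ends_equiv (hΓ : Γ.IsImmersion) (hG : IsCubicGraph G)
    {c : E(G) → Color} (hc : IsProperEdgeColoring G c) :
    ∃ φ : E(G) × Bool ≃ V(G) × Color, ∀ h, Γ.base h = Γ.pos (φ h).1 ∧ (φ h).2 = c h.1 := by
  choose vert hvert using hΓ.exists_base_eq
  rw [hΓ.isProperEdgeColoring_iff hG] at hc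
  refine ⟨Equiv.ofBijective (fun h => (vert h, c h.1)) ⟨?_, ?_⟩, fun h => ⟨hvert h, rfl⟩⟩
  · intro h h' hh
    obtain ⟨hv, hcol⟩ := Prod.ext_iff.1 hh
    obtain ⟨l, hl⟩ := (hΓ.base_eq_pos_iff hG h (vert h)).1 (hvert h)
    obtain ⟨l', hl'⟩ := (hΓ.base_eq_pos_iff hG h' (vert h)).1
      (by rw [hvert h']; exact congrArg _ hv.symm)
    have : l = l' := injective_of_surjective_color (hc (vert h)) (by simpa [hl, hl'] using hcol)
    rw [← hl, ← hl', this]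
  · rintro ⟨v, κ⟩
    obtain ⟨l, rfl⟩ := hc v κ
    refine ⟨hΓ.legs hG v l, Prod.ext (hΓ.pos_injective ?_) rfl⟩
    rw [← hvert, hΓ.base_legs]

variable (Γ) in
/-- The pairs of interior parameters at which two edges meet. -/
def meetings (e e' : E(G)) : Set (ℝ × ℝ) :=
  {x | x.1 ∈ Set.Ioo (0 : ℝ) 1 ∧ x.2 ∈ Set.Ioo (0 : ℝ) 1 ∧ Γ.curve e x.1 = Γ.curve e' x.2}

theorem IsImmersion.finite_meetings (hΓ : Γ.IsImmersion) {e e' : E(G)} (h : e ≠ e') :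
    (Γ.meetings e e').Finite := by
  refine ((hΓ.finite_cutTimes e).prod (hΓ.finite_cutTimes e')).subset ?_
  rintro ⟨s, t⟩ ⟨hs, ht, hst⟩
  exact ⟨⟨hs, (e', ⟨t, ht⟩), fun h' => h (Prod.ext_iff.1 h').1.symm, hst.symm⟩,
    ⟨ht, (e, ⟨s, hs⟩), fun h' => h (Prod.ext_iff.1 h').1, hst⟩⟩

theorem im_conj_mul_ne_zero {z w : ℂ} (h : LinearIndependent ℝ ![z, w]) :
    (conj z * w).im ≠ 0 := by
  intro h0
  have hz : z ≠ 0 := h.ne_zero 0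
  rw [LinearIndependent.pair_iff] at h
  have := h (conj z * w).re (-Complex.normSq z) ?_
  · exact hz (Complex.normSq_eq_zero.1 (neg_eq_zero.1 this.2))
  · have e : (((conj z * w).re : ℝ) : ℂ) = conj z * w := by
      apply Complex.ext
      · simp only [Complex.ofReal_re]
      · rw [h0, Complex.ofReal_im]
    rw [Complex.real_smul, Complex.real_smul, e, Complex.ofReal_neg, ← Complex.mul_conj]
    ring

/-- The parity of the number of crossings of differently coloured edges, as a product of local
contributions of the vertices. -/
theorem IsImmersion.prod_neg_one_pow_meetings (hΓ : Γ.IsImmersion) [Fintype V(G)]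
    [Fintype E(G)] {c : E(G) → Color} (φ : E(G) × Bool ≃ V(G) × Color)
    (hφ : ∀ h, Γ.base h = Γ.pos (φ h).1 ∧ (φ h).2 = c h.1) :
    (∏ e : E(G), ∏ e' : E(G), if c e' = (c e).next then (-1 : ℂ) ^ (Γ.meetings e e').ncard else 1) =
      ∏ v, ∏ x : Color, sqrtDir (-Γ.out (φ.symm (v, x)) / Γ.out (φ.symm (v, x.next))) := by
  classical
  have hbase : ∀ v x, Γ.base (φ.symm (v, x)) = Γ.pos v := fun v x => by
    rw [(hφ _).1, Equiv.apply_symm_apply]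
  -- A loop would have two ends with the same vertex and the same colour.
  have hends : ∀ e, Γ.curve e 0 ≠ Γ.curve e 1 := by
    intro e h
    have h1 := (hφ (e, false)).1
    have h2 := (hφ (e, true)).1
    rw [base_eq] at h1 h2
    have h3 : φ (e, false) = φ (e, true) := by
      refine Prod.ext (hΓ.pos_injective ?_) ?_
      · rw [← h1, ← h2]
        simpa [endParam] using h
      · rw [(hφ _).2, (hφ _).2]
    simpa using φ.injective h3
  have hη : ∀ e v, ∃ η : ℂ, η ^ 2 = 1 ∧ SqrtHol (fun s => Γ.curve e s - Γ.pos v)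
      (η * (sqrtDir (endDir (Γ.curve e) (Γ.velocity e) true (Γ.pos v)) /
        sqrtDir (endDir (Γ.curve e) (Γ.velocity e) false (Γ.pos v)))) := fun e v =>
    (hΓ.regularArc e).exists_sqrtHol_sub (hends e) (fun s hs => hΓ.curve_ne_pos e s hs v)
  choose η hη1 hη2 using hη
  have hend : ∀ e i, Γ.curve e (endParam i) = Γ.pos (φ (e, i)).1 := fun e i => by
    rw [← (hφ (e, i)).1, base_eq]
  have pair : ∀ e e', c e' = (c e).next → (-1 : ℂ) ^ (Γ.meetings e e').ncard =
      (∏ j, η e (φ (e', j)).1) * (∏ i, η e' (φ (e, i)).1) *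
      ∏ i, ∏ j, endTurn (Γ.base (e, i)) (Γ.out (e, i)) (Γ.base (e', j)) (Γ.out (e', j)) := by
    intro e e' hc
    have hne : e ≠ e' := by
      rintro rfl
      exact Color.next_ne _ hc.symm
    have hfin := hΓ.finite_meetings hne
    have := (hΓ.regularArc e).neg_one_pow_card (hΓ.regularArc e') ?_ ?_ ?_ hfin.toFinset
      (fun x => hfin.mem_toFinset) ?_ (η := fun j => η e (φ (e', j)).1)
      (θ := fun i => η e' (φ (e, i)).1) (fun _ => hη1 _ _) (fun _ => hη1 _ _) ?_ ?_
    · rw [Set.ncard_eq_toFinset_card _ hfin, this]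
      simp only [base_eq, out_eq]
    · intro s hs j
      rw [hend]
      exact hΓ.curve_ne_pos _ s hs _
    · intro s hs i
      rw [hend]
      exact (hΓ.curve_ne_pos _ s hs _).symm
    · intro i j h
      rw [← out_eq (e, i), ← out_eq (e', j)]
      exact hΓ.not_sameRay _ _ (fun h' => hne (Prod.ext_iff.1 h').1) h
    · intro x hx
      obtain ⟨h1, h2, h3⟩ := hfin.mem_toFinset.1 hx
      exact im_conj_mul_ne_zero (hΓ.transverse e e' _ h1 _ h2
        (fun h' => hne (Prod.ext_iff.1 h').1) h3)
    · intro j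
      rw [hend]
      exact hη2 _ _
    · intro i
      rw [hend]
      exact hη2 _ _
  have step : ∀ e e', (if c e' = (c e).next then (-1 : ℂ) ^ (Γ.meetings e e').ncard else 1) =
      if c e' = (c e).next then (∏ j, η e (φ (e', j)).1) * (∏ i, η e' (φ (e, i)).1) *
      ∏ i, ∏ j, endTurn (Γ.base (e, i)) (Γ.out (e, i)) (Γ.base (e', j)) (Γ.out (e', j))
      else 1 := by
    intro e e'
    split_ifs with h
    · exact pair e e' h
    · rfl
  simp_rw [step]
  rw [prod_next_eq_prod_vertex c φ (fun h => (hφ h).2) η hη1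
    (fun h h' => endTurn (Γ.base h) (Γ.out h) (Γ.base h') (Γ.out h'))]
  · refine Finset.prod_congr rfl fun v _ => ?_
    simp only [hbase, endTurn, if_true]
    have hr : ∀ x, sqrtDir (Γ.out (φ.symm (v, x))) ≠ 0 := fun x => sqrtDir_ne_zero _
    -- The quotients of roots of tangents in `endTurn` cancel around the cycle of the three colours.
    rw [Finset.prod_mul_distrib, Finset.prod_div_distrib,
      Color.next_bijective.prod_comp (fun x => sqrtDir (Γ.out (φ.symm (v, x)))),
      div_self (Finset.prod_ne_zero_iff.2 fun x _ => hr x), one_mul]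
  · intro v w x y hvw
    simp only [hbase]
    exact endTurn_mul_swap fun h => hvw (hΓ.pos_injective h)

theorem Crossing.strandPoint_spec (p : Γ.Crossing) : p.strandPoint 0 ≠ p.strandPoint 1 ∧
    ∀ s, Γ.curve (p.strandPoint s).1 (p.strandPoint s).2 = p := by
  obtain ⟨h1, h2, h3⟩ := p.2.choose_spec.choose_spec
  refine ⟨h1, fun s => ?_⟩
  fin_cases s
  exacts [h2, h3]

/-- Without triple points, the chosen strands of a crossing are unique up to order. -/
theorem IsImmersion.strandPoint_eq_or (hΓ : Γ.IsImmersion) {x y : E(G) × Set.Ioo (0 : ℝ) 1}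
    (hxy : x ≠ y) (p : Γ.Crossing) (hx : Γ.curve x.1 x.2 = p) (hy : Γ.curve y.1 y.2 = p) :
    (x = p.strandPoint 0 ∧ y = p.strandPoint 1) ∨ (x = p.strandPoint 1 ∧ y = p.strandPoint 0) := by
  obtain ⟨hne, hp⟩ := p.strandPoint_spec
  have key : ∀ z : E(G) × Set.Ioo (0 : ℝ) 1, Γ.curve z.1 z.2 = p →
      z = p.strandPoint 0 ∨ z = p.strandPoint 1 := by
    intro z hz
    rcases hΓ.no_triple_point z (p.strandPoint 0) (p.strandPoint 1) (hz.trans (hp 0).symm)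
      ((hp 0).trans (hp 1).symm) with h | h | h
    exacts [Or.inl h, (hne h).elim, Or.inr h]
  rcases key x hx with rfl | rfl <;> rcases key y hy with rfl | rfl
  · exact (hxy rfl).elim
  · exact Or.inl ⟨rfl, rfl⟩
  · exact Or.inr ⟨rfl, rfl⟩
  · exact (hxy rfl).elim

theorem IsImmersion.finite_crossing (hΓ : Γ.IsImmersion) [Finite E(G)] : Finite Γ.Crossing := by
  have hfin : (⋃ e, Γ.curve e '' Γ.cutTimes e).Finite :=
    Set.finite_iUnion fun e => (hΓ.finite_cutTimes e).image _
  refine (hfin.subset ?_).to_subtype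
  rintro p ⟨x, y, hxy, hx, hy⟩
  refine Set.mem_iUnion.2 ⟨x.1, x.2, ⟨x.2.2, y, fun h => hxy ?_, hy.trans hx.symm⟩, hx⟩
  obtain ⟨h1, h2⟩ := Prod.ext_iff.1 h
  exact Prod.ext h1.symm (Subtype.ext h2.symm)

/-- Of two different colours exactly one is the successor of the other. So a crossing of differently
coloured edges is a meeting for exactly one ordered pair of edges on the right, and crossings of
equally coloured edges, self-crossings included, contribute `1`. -/
theorem IsImmersion.prod_crossing (hΓ : Γ.IsImmersion) [Fintype E(G)] [Fintype Γ.Crossing]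
    (c : E(G) → Color) :
    (∏ p : Γ.Crossing, if c (p.strandPoint 0).1 = c (p.strandPoint 1).1 then (1 : ℂ) else -1) =
      ∏ e : E(G), ∏ e' : E(G),
        if c e' = (c e).next then (-1 : ℂ) ^ (Γ.meetings e e').ncard else 1 := by
  classical
  let Z : E(G) × E(G) → Finset (ℝ × ℝ) := fun ee =>
    if h : (Γ.meetings ee.1 ee.2).Finite then h.toFinset else ∅
  have hZ : ∀ {e e' : E(G)}, c e' = (c e).next → ∀ x, x ∈ Z (e, e') ↔ x ∈ Γ.meetings e e' := by
    intro e e' h x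
    have hne : e ≠ e' := by
      rintro rfl
      exact Color.next_ne _ h.symm
    simp only [Z, dif_pos (hΓ.finite_meetings hne), Set.Finite.mem_toFinset]
  have hcard : ∀ e e' : E(G), c e' = (c e).next → (Γ.meetings e e').ncard = (Z (e, e')).card := by
    intro e e' h
    rw [← Set.ncard_coe_finset]
    congr 1
    ext x
    exact (hZ h x).symm
  rw [← Fintype.prod_prod_type' (f := fun e e' =>
    if c e' = (c e).next then (-1 : ℂ) ^ (Γ.meetings e e').ncard else 1), ← Finset.prod_filter,
    Finset.prod_congr rfl (g := fun ee => ∏ _x ∈ Z ee, (-1 : ℂ)), Finset.prod_sigma']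
  swap
  · rintro ⟨e, e'⟩ h
    rw [Finset.prod_const, hcard e e' (Finset.mem_filter.1 h).2]
  have hlhs : (∏ p : Γ.Crossing,
      if c (p.strandPoint 0).1 = c (p.strandPoint 1).1 then (1 : ℂ) else -1) =
      ∏ p : Γ.Crossing with ¬ c (p.strandPoint 0).1 = c (p.strandPoint 1).1, (-1 : ℂ) := by
    rw [Finset.prod_filter]
    refine Finset.prod_congr rfl fun p _ => ?_
    by_cases h : c (p.strandPoint 0).1 = c (p.strandPoint 1).1 <;> simp [h]
  rw [hlhs, Finset.prod_const, Finset.prod_const]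
  congr 1
  symm
  have mem : ∀ a : (_ : E(G) × E(G)) × (ℝ × ℝ), a ∈ (Finset.univ.filter
      (fun ee : E(G) × E(G) => c ee.2 = (c ee.1).next)).sigma Z →
      c a.1.2 = (c a.1.1).next ∧ a.2 ∈ Γ.meetings a.1.1 a.1.2 := by
    intro a ha
    obtain ⟨h1, h2⟩ := Finset.mem_sigma.1 ha
    have h1 := (Finset.mem_filter.1 h1).2
    exact ⟨h1, (hZ h1 _).1 h2⟩
  have ne : ∀ {e e' : E(G)} {s t : Set.Ioo (0 : ℝ) 1}, c e' = (c e).next → (e, s) ≠ (e', t) := by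
    intro e e' s t h h'
    have h' : e = e' := (Prod.ext_iff.1 h').1
    rw [h'] at h
    exact Color.next_ne _ h.symm
  refine Finset.card_bij (fun a ha => ⟨Γ.curve a.1.1 a.2.1,
    (a.1.1, ⟨a.2.1, (mem a ha).2.1⟩), (a.1.2, ⟨a.2.2, (mem a ha).2.2.1⟩), ne (mem a ha).1, rfl,
      (mem a ha).2.2.2.symm⟩) ?_ ?_ ?_
  · rintro ⟨⟨e, e'⟩, s, t⟩ ha
    obtain ⟨hc, hs, ht, hst⟩ := mem _ ha
    rw [Finset.mem_filter]
    refine ⟨Finset.mem_univ _, ?_⟩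
    rcases hΓ.strandPoint_eq_or (x := (e, ⟨s, hs⟩)) (y := (e', ⟨t, ht⟩)) (ne hc)
      ⟨Γ.curve e s, (e, ⟨s, hs⟩), (e', ⟨t, ht⟩), ne hc, rfl, hst.symm⟩ rfl hst.symm
      with ⟨h1, h2⟩ | ⟨h1, h2⟩
    · rw [← h1, ← h2, hc]
      exact (Color.next_ne _).symm
    · rw [← h1, ← h2, hc]
      exact Color.next_ne _
  · rintro ⟨⟨e, e'⟩, s, t⟩ ha ⟨⟨f, f'⟩, u, v⟩ hb hab
    obtain ⟨hc, hs, ht, hst⟩ := mem _ ha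
    obtain ⟨hc', hu, hv, huv⟩ := mem _ hb
    have hab : Γ.curve e s = Γ.curve f u := congrArg Subtype.val hab
    let p : Γ.Crossing := ⟨Γ.curve e s, (e, ⟨s, hs⟩), (e', ⟨t, ht⟩), ne hc, rfl, hst.symm⟩
    have h1 := hΓ.strandPoint_eq_or (x := (e, ⟨s, hs⟩)) (y := (e', ⟨t, ht⟩)) (ne hc) p rfl hst.symm
    have h2 := hΓ.strandPoint_eq_or (x := (f, ⟨u, hu⟩)) (y := (f', ⟨v, hv⟩)) (ne hc') p
      hab.symm (huv.symm.trans hab.symm)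
    have same : ∀ {x y : E(G) × Set.Ioo (0 : ℝ) 1}, x = y → x.1 = y.1 ∧ (x.2 : ℝ) = y.2 := by
      rintro x y rfl
      exact ⟨rfl, rfl⟩
    have fin : ∀ {x y : E(G) × Set.Ioo (0 : ℝ) 1}, ((e, ⟨s, hs⟩) = x ∧ (e', ⟨t, ht⟩) = y) →
        ((f, ⟨u, hu⟩) = x ∧ (f', ⟨v, hv⟩) = y) →
        (⟨(e, e'), s, t⟩ : (_ : E(G) × E(G)) × (ℝ × ℝ)) = ⟨(f, f'), u, v⟩ := by
      rintro x y ⟨a1, a2⟩ ⟨b1, b2⟩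
      obtain ⟨rfl, rfl⟩ := same (a1.trans b1.symm)
      obtain ⟨rfl, rfl⟩ := same (a2.trans b2.symm)
      rfl
    have bad : ∀ {x y : E(G) × Set.Ioo (0 : ℝ) 1}, ((e, ⟨s, hs⟩) = x ∧ (e', ⟨t, ht⟩) = y) →
        ((f, ⟨u, hu⟩) = y ∧ (f', ⟨v, hv⟩) = x) → False := by
      rintro x y ⟨a1, a2⟩ ⟨b1, b2⟩
      obtain ⟨rfl, -⟩ := same (a1.trans b2.symm)
      obtain ⟨rfl, -⟩ := same (a2.trans b1.symm)
      simp only at hc hc'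
      rw [hc] at hc'
      exact Color.next_next_ne _ hc'.symm
    rcases h1 with h1 | h1 <;> rcases h2 with h2 | h2
    exacts [fin h1 h2, (bad h1 h2).elim, (bad h1 h2).elim, fin h1 h2]
  · intro p hp
    obtain ⟨-, hcur⟩ := p.strandPoint_spec
    have hp := (Finset.mem_filter.1 hp).2
    have fin : ∀ i j, c (p.strandPoint j).1 = (c (p.strandPoint i).1).next →
        ∃ a, ∃ (ha : a ∈ (Finset.univ.filter
          (fun ee : E(G) × E(G) => c ee.2 = (c ee.1).next)).sigma Z),
          Γ.curve a.1.1 a.2.1 = p := by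
      intro i j h
      refine ⟨⟨((p.strandPoint i).1, (p.strandPoint j).1), (p.strandPoint i).2,
        (p.strandPoint j).2⟩, ?_, hcur i⟩
      rw [Finset.mem_sigma]
      refine ⟨Finset.mem_filter.2 ⟨Finset.mem_univ _, h⟩, (hZ h _).2 ⟨(p.strandPoint i).2.2,
        (p.strandPoint j).2.2, ?_⟩⟩
      exact (hcur i).trans (hcur j).symm
    rcases Color.eq_next_or _ _ hp with h | h
    · obtain ⟨a, ha, e⟩ := fin 0 1 h
      exact ⟨a, ha, Subtype.ext e⟩
    · obtain ⟨a, ha, e⟩ := fin 1 0 h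
      exact ⟨a, ha, Subtype.ext e⟩

/-! ### From colourings of arcs to colourings of edges. -/

/-- The element with `k` predecessors is the parameter at which the arc `k` of an edge ends and the
arc `k + 1` starts. -/
theorem exists_ncard_inter_Iio {T : Set ℝ} (hT : T.Finite) {k : ℕ} (hk : k < T.ncard) :
    ∃ t ∈ T, (T ∩ Set.Iio t).ncard = k ∧ (T ∩ Set.Iic t).ncard = k + 1 := by
  lift T to Finset ℝ using hT
  rw [Set.ncard_coe_finset] at hk
  let f := T.orderEmbOfFin rfl
  have hr : Set.range f = T := T.range_orderEmbOfFin rfl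
  refine ⟨f ⟨k, hk⟩, T.orderEmbOfFin_mem rfl _, ?_, ?_⟩
  · have : (T : Set ℝ) ∩ Set.Iio (f ⟨k, hk⟩) = f '' Set.Iio ⟨k, hk⟩ := by
      rw [← hr]
      ext x
      constructor
      · rintro ⟨⟨i, rfl⟩, hi⟩
        exact ⟨i, f.lt_iff_lt.1 hi, rfl⟩
      · rintro ⟨i, hi, rfl⟩
        exact ⟨⟨i, rfl⟩, f.lt_iff_lt.2 hi⟩
    rw [this, Set.ncard_image_of_injective _ f.injective, ← Finset.coe_Iio, Set.ncard_coe_finset,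
      Fin.card_Iio]
  · have : (T : Set ℝ) ∩ Set.Iic (f ⟨k, hk⟩) = f '' Set.Iic ⟨k, hk⟩ := by
      rw [← hr]
      ext x
      constructor
      · rintro ⟨⟨i, rfl⟩, hi⟩
        exact ⟨i, f.le_iff_le.1 hi, rfl⟩
      · rintro ⟨i, hi, rfl⟩
        exact ⟨⟨i, rfl⟩, f.le_iff_le.2 hi⟩
    rw [this, Set.ncard_image_of_injective _ f.injective, ← Finset.coe_Iic, Set.ncard_coe_finset,
      Fin.card_Iic]

/-- Consecutive arcs of an edge form a strand of a crossing, so the colour propagates from arc `0`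
by induction. -/
theorem IsImmersion.eq_comp_fst (hΓ : Γ.IsImmersion) {c : Γ.Arc → Color}
    (hc : ∀ (p : Γ.Crossing) (s : Fin 2),
      c (hΓ.arcBefore (p.strandPoint s).1 (p.strandPoint s).2) =
        c (hΓ.arcAfter (p.strandPoint s).1 (p.strandPoint s).2)) (a : Γ.Arc) :
    c a = c ⟨a.1, 0⟩ := by
  obtain ⟨e, k, hk⟩ := a
  induction k with
  | zero => rfl
  | succ k ih =>
    rw [← ih (by omega)]
    obtain ⟨t, ht, h1, h2⟩ := exists_ncard_inter_Iio (hΓ.finite_cutTimes e)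
      (show k < (Γ.cutTimes e).ncard by omega)
    obtain ⟨ht01, x, hx, hcur⟩ := ht
    have hne : x ≠ (e, ⟨t, ht01⟩) := by
      rintro rfl
      exact hx rfl
    let p : Γ.Crossing := ⟨Γ.curve e t, x, (e, ⟨t, ht01⟩), hne, hcur, rfl⟩
    have hs : ∃ s, p.strandPoint s = (e, ⟨t, ht01⟩) := by
      rcases hΓ.strandPoint_eq_or hne p hcur rfl with h | h
      exacts [⟨1, h.2.symm⟩, ⟨0, h.2.symm⟩]
    obtain ⟨s, hs⟩ := hs
    have := hc p s
    rw [hs] at this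
    simp only [arcBefore, arcAfter, h1, h2] at this
    exact this.symm

theorem IsImmersion.endArc_fst (hΓ : Γ.IsImmersion) (h : E(G) × Bool) :
    (hΓ.endArc h).1 = h.1 := by
  obtain ⟨e, b⟩ := h
  cases b <;> rfl

theorem nodeTensor_ne_zero {i j k : Color} (h : nodeTensor i j k ≠ 0) : i ≠ j ∧ i ≠ k ∧ j ≠ k := by
  revert h
  cases i <;> cases j <;> cases k <;> simp [nodeTensor, epsilonTensor]

/-- **Extending the Penrose bracket to all cubic graphs.** The bracket of an immersed cubic graph
counts its proper edge colourings. -/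
theorem IsImmersion.bracket_diagram [Finite V(G)] [Finite E(G)] (hG : IsCubicGraph G)
    (hΓ : Γ.IsImmersion) :
    (hΓ.diagram hG).bracket = (Nat.card {c : E(G) → Color // IsProperEdgeColoring G c} : ℂ) := by
  classical
  have := hΓ.finite_crossing
  have := Fintype.ofFinite V(G)
  have := Fintype.ofFinite E(G)
  have := Fintype.ofFinite Γ.Crossing
  have := Fintype.ofFinite Γ.Arc
  rw [Tangle.bracket, finsum_eq_sum_of_fintype]
  simp only [finprod_eq_prod_of_fintype]
  have hinj : Function.Injective (fun (c : E(G) → Color) (a : Γ.Arc) => c a.1) := by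
    intro c c' h
    funext e
    exact congrFun h ⟨e, 0⟩
  -- Colourings of the edges are the arc colourings that are constant along edges; all others are
  -- killed by some crossing.
  rw [← Fintype.sum_of_injective _ hinj
    (fun c : E(G) → Color => if IsProperEdgeColoring G c then (1 : ℂ) else 0)]
  · rw [Finset.sum_boole, Nat.card_eq_fintype_card, Fintype.card_subtype]
  · intro c hc
    by_contra hne
    refine hc ⟨fun e => c ⟨e, 0⟩, funext fun a => (hΓ.eq_comp_fst (fun p s => ?_) a).symm⟩
    have h := (Finset.prod_ne_zero_iff.1 (right_ne_zero_of_mul hne)) p (Finset.mem_univ _)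
    simp only [diagram, crossingTensor, ne_eq, ite_eq_right_iff, Classical.not_imp] at h
    fin_cases s
    exacts [h.1.1, h.1.2]
  · intro c
    have hX : ∀ p : Γ.Crossing, crossingTensor ((hΓ.diagram hG).kind p)
        (c ((hΓ.diagram hG).strand p 0 0).1) (c ((hΓ.diagram hG).strand p 0 1).1)
        (c ((hΓ.diagram hG).strand p 1 0).1) (c ((hΓ.diagram hG).strand p 1 1).1) =
        if c (p.strandPoint 0).1 = c (p.strandPoint 1).1 then (1 : ℂ) else -1 := by
      intro p
      simp [diagram, crossingTensor, arcBefore, arcAfter]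
    have hN : ∀ v l, ((hΓ.diagram hG).leg v l).1 = (hΓ.legs hG v l).1 := fun v l =>
      hΓ.endArc_fst _
    simp only [hX, hN]
    split_ifs with hc
    · obtain ⟨φ, hφ⟩ := hΓ.exists_ends_equiv hG hc
      rw [hΓ.prod_crossing c, hΓ.prod_neg_one_pow_meetings φ hφ, ← Finset.prod_mul_distrib]
      refine (Finset.prod_eq_one fun v _ => ?_).symm
      have hsymm : ∀ l, φ.symm (v, c (hΓ.legs hG v l).1) = hΓ.legs hG v l := by
        intro l
        rw [Equiv.symm_apply_eq]
        refine Prod.ext (hΓ.pos_injective ?_) (hφ _).2.symm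
        rw [← (hφ _).1, hΓ.base_legs]
      have hli := injective_of_surjective_color ((hΓ.isProperEdgeColoring_iff hG c).1 hc v)
      refine nodeTensor_mul_prod_sqrtDir (d := fun x => Γ.out (φ.symm (v, x)))
        (hli.ne (by decide)) (hli.ne (by decide)) (hli.ne (by decide))
        (fun x => hΓ.out_ne_zero _) (fun x y hxy => hΓ.not_sameRay _ _ ?_ ?_) ?_
      · intro h
        exact hxy (Prod.ext_iff.1 (φ.symm.injective h)).2
      · rw [(hφ _).1, (hφ _).1, Equiv.apply_symm_apply, Equiv.apply_symm_apply]
      · simp only [hsymm]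
        exact hΓ.clockwise_legs hG v
    · symm
      rw [hΓ.isProperEdgeColoring_iff hG] at hc
      push Not at hc
      obtain ⟨v, hv⟩ := hc
      refine mul_eq_zero_of_left (Finset.prod_eq_zero (Finset.mem_univ v) ?_) _
      by_contra hne
      obtain ⟨h01, h02, h12⟩ := nodeTensor_ne_zero hne
      apply hv
      exact surjective_of_ne h01 h02 h12

end PlaneDrawing

/-! ### Gluing and the relations of the bracket. -/

namespace Tangle

variable {k : ℕ} {A N X A' N' X' : Type*}

/-- The contribution of a colouring of the arcs to the bracket. -/
noncomputable def weight (T : Tangle k A N X) (c : A → Color) : ℂ :=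
  (∏ᶠ n : N, nodeTensor (c (T.leg n 0)) (c (T.leg n 1)) (c (T.leg n 2))) *
    ∏ᶠ x : X, crossingTensor (T.kind x) (c (T.strand x 0 0)) (c (T.strand x 0 1))
      (c (T.strand x 1 0)) (c (T.strand x 1 1))

theorem bracket_eq_sum [Fintype A] [DecidableEq A] (D : Diagram A N X) :
    D.bracket = ∑ c, D.weight c :=
  finsum_eq_sum_of_fintype _

theorem weight_glue [Finite N] [Finite X] [Finite N'] [Finite X'] (T : Tangle k A N X)
    (P : Tangle k A' N' X') (q : Quot (GlueRel T P) → Color) :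
    (T.glue P).weight q = T.weight (fun a => q (Quot.mk _ (Sum.inl a))) *
      P.weight (fun a => q (Quot.mk _ (Sum.inr a))) := by
  have := Fintype.ofFinite N
  have := Fintype.ofFinite X
  have := Fintype.ofFinite N'
  have := Fintype.ofFinite X'
  simp only [weight, finprod_eq_prod_of_fintype, Fintype.prod_sum_type]
  simp only [glue, Sum.elim_inl, Sum.elim_inr]
  ring

/-- Colourings of the glued arcs are the pairs of colourings that agree at the joined ends, and the
weight is multiplicative. -/
theorem bracket_glue [Fintype A] [DecidableEq A] [Fintype A'] [DecidableEq A'] [Finite N]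
    [Finite X] [Finite N'] [Finite X'] (T : Tangle k A N X) (P : Tangle k A' N' X') :
    (T.glue P).bracket = ∑ c : A → Color, ∑ c' : A' → Color,
      if ∀ i, c (T.bd i) = c' (P.bd i) then T.weight c * P.weight c' else 0 := by
  classical
  have := Fintype.ofFinite (Quot (GlueRel T P))
  rw [bracket_eq_sum, ← Fintype.sum_prod_type' (f := fun (c : A → Color) (c' : A' → Color) =>
    if ∀ i, c (T.bd i) = c' (P.bd i) then T.weight c * P.weight c' else 0)]
  refine Fintype.sum_of_injective (fun q : Quot (GlueRel T P) → Color =>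
    ((fun a => q (Quot.mk _ (Sum.inl a)), fun a => q (Quot.mk _ (Sum.inr a))) :
      (A → Color) × (A' → Color))) ?_ _ _ ?_ ?_
  · intro q q' h
    obtain ⟨h1, h2⟩ := Prod.ext_iff.1 h
    funext z
    obtain ⟨a | a, rfl⟩ := Quot.exists_rep z
    exacts [congrFun h1 a, congrFun h2 a]
  · rintro ⟨c, c'⟩ hc
    refine if_neg fun h => hc ⟨Quot.lift (Sum.elim c c') ?_, rfl⟩
    rintro _ _ ⟨i⟩
    exact h i
  · intro q
    have : ∀ i, Quot.mk (GlueRel T P) (Sum.inl (T.bd i)) = Quot.mk _ (Sum.inr (P.bd i)) :=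
      fun i => Quot.sound ⟨i⟩
    simp only [this, implies_true, if_true]
    exact T.weight_glue P q

theorem weight_of_isEmpty [IsEmpty N] [IsEmpty X] (T : Tangle k A N X) (c : A → Color) :
    T.weight c = 1 := by
  simp [weight, finprod_of_isEmpty]

theorem bracket_circle : circle.bracket = 3 := by
  rw [bracket_eq_sum]
  simp only [weight_of_isEmpty, Finset.sum_const, Finset.card_univ, Fintype.card_pi, nsmul_eq_mul,
    mul_one]
  have : Fintype.card Color = 3 := rfl
  simp [this]

theorem bracket_circle_glue [Finite A] [Finite N] [Finite X] (D : Diagram A N X) :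
    (circle.glue D).bracket = 3 * D.bracket := by
  classical
  have := Fintype.ofFinite A
  rw [bracket_glue, ← bracket_circle, bracket_eq_sum circle, bracket_eq_sum D, Finset.sum_mul_sum]
  simp

theorem weight_withKind [Fintype X] [DecidableEq X] (D : Tangle k A N X) (x : X) (κ : CrossingKind)
    (c : A → Color) : (D.withKind x κ).weight c =
      crossingTensor κ (c (D.strand x 0 0)) (c (D.strand x 0 1)) (c (D.strand x 1 0))
        (c (D.strand x 1 1)) *
      ((∏ᶠ n : N, nodeTensor (c (D.leg n 0)) (c (D.leg n 1)) (c (D.leg n 2))) *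
        ∏ y ∈ Finset.univ.erase x, crossingTensor (D.kind y) (c (D.strand y 0 0))
          (c (D.strand y 0 1)) (c (D.strand y 1 0)) (c (D.strand y 1 1))) := by
  rw [weight, finprod_eq_prod_of_fintype (α := X), ← Finset.mul_prod_erase _ _ (Finset.mem_univ x)]
  have h : ∏ y ∈ Finset.univ.erase x, crossingTensor ((D.withKind x κ).kind y)
      (c ((D.withKind x κ).strand y 0 0)) (c ((D.withKind x κ).strand y 0 1))
      (c ((D.withKind x κ).strand y 1 0)) (c ((D.withKind x κ).strand y 1 1)) =
      ∏ y ∈ Finset.univ.erase x, crossingTensor (D.kind y) (c (D.strand y 0 0))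
          (c (D.strand y 0 1)) (c (D.strand y 1 0)) (c (D.strand y 1 1)) := by
    refine Finset.prod_congr rfl fun y hy => ?_
    have hk : (D.withKind x κ).kind y = D.kind y :=
      @Function.update_of_ne _ _ (Classical.decEq X) _ _ (Finset.ne_of_mem_erase hy) _ _
    rw [hk]
    rfl
  rw [h]
  simp only [withKind, Function.update_self]
  ring

/-- On strands of constant colour this says `1 = 2 - 1` for equal colours and `-1 = 0 - 1` for
different ones. -/
theorem crossingTensor_circled (x x' y y' : Color) : crossingTensor .circled x x' y y' =
    2 * crossingTensor .dotted x x' y y' - crossingTensor .plain x x' y y' := by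
  simp only [crossingTensor]
  by_cases h : x = x' <;> by_cases h' : y = y' <;> by_cases h'' : x = y <;> simp_all
  norm_num

theorem bracket_of_kind_eq_circled [Finite A] [Finite X] (D : Diagram A N X) (x : X)
    (h : D.kind x = .circled) :
    D.bracket = 2 * (D.withKind x .dotted).bracket - (D.withKind x .plain).bracket := by
  classical
  have := Fintype.ofFinite A
  have := Fintype.ofFinite X
  have hD : D = D.withKind x .circled := by
    simp [withKind, ← h]
  rw [bracket_eq_sum, bracket_eq_sum, bracket_eq_sum, Finset.mul_sum,
    ← Finset.sum_sub_distrib]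
  refine Finset.sum_congr rfl fun c _ => ?_
  nth_rw 1 [hD]
  rw [weight_withKind, weight_withKind, weight_withKind, crossingTensor_circled]
  ring

theorem nodeTensor_rotate (i j k : Color) : nodeTensor j k i = nodeTensor i j k := by
  cases i <;> cases j <;> cases k <;> rfl

/-- Cyclic symmetry lets the reading of a node start at any slot; addition in `Fin 3` wraps around.
-/
theorem nodeTensor_from (f : Fin 3 → Color) (i : Fin 3) :
    nodeTensor (f 0) (f 1) (f 2) = nodeTensor (f i) (f (i + 1)) (f (i + 2)) := by
  fin_cases i
  · rfl
  · exact (nodeTensor_rotate _ _ _).symm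
  · exact nodeTensor_rotate _ _ _

/-- This is the contraction of two epsilon tensors over one index. The square of `√-1` reverses its
usual sign, so the parallel term is the positive one. -/
theorem sum_nodeTensor_mul (w x y z : Color) :
    ∑ v, nodeTensor v w x * nodeTensor v y z =
      (if w = z ∧ x = y then 1 else 0) - (if w = y ∧ x = z then 1 else 0) := by
  have hI := Complex.I_mul_I
  have : (Finset.univ : Finset Color) = {.r, .b, .p} := rfl
  rw [this, Finset.sum_insert (by decide), Finset.sum_insert (by decide), Finset.sum_singleton]
  cases w <;> cases x <;> cases y <;> cases z <;> simp [nodeTensor, epsilonTensor, hI]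

section Penrose

variable {D : Diagram A N X} (Y : YForm D)

theorem YForm.weight_eq [Finite N] (c : A → Color) : D.weight c =
    nodeTensor (c Y.edge) (c (Y.outside.bd 0)) (c (Y.outside.bd 1)) *
      nodeTensor (c Y.edge) (c (Y.outside.bd 2)) (c (Y.outside.bd 3)) *
      Y.outside.weight (fun a => c a) := by
  classical
  have := Fintype.ofFinite N
  have h1 : ∏ n, nodeTensor (c (D.leg n 0)) (c (D.leg n 1)) (c (D.leg n 2)) =
      nodeTensor (c Y.edge) (c (Y.outside.bd 0)) (c (Y.outside.bd 1)) *
      (nodeTensor (c Y.edge) (c (Y.outside.bd 2)) (c (Y.outside.bd 3)) *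
      ∏ n : {n // n ≠ Y.u ∧ n ≠ Y.v},
        nodeTensor (c (D.leg n 0)) (c (D.leg n 1)) (c (D.leg n 2))) := by
    rw [← Finset.mul_prod_erase _ _ (Finset.mem_univ Y.u),
      ← Finset.mul_prod_erase _ _ (Finset.mem_erase.2 ⟨Y.u_ne_v.symm, Finset.mem_univ Y.v⟩),
      Finset.prod_subtype (p := fun n => n ≠ Y.u ∧ n ≠ Y.v) ((Finset.univ.erase Y.u).erase Y.v)
        (by simp [and_comm]),
      nodeTensor_from (fun l => c (D.leg Y.u l)) Y.i, nodeTensor_from (fun l => c (D.leg Y.v l)) Y.j]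
    simp only [Y.leg_u, Y.leg_v]
    rfl
  rw [weight, weight, finprod_eq_prod_of_fintype (α := N),
    finprod_eq_prod_of_fintype (α := {n // n ≠ Y.u ∧ n ≠ Y.v}), h1]
  simp only [YForm.outside]
  ring

/-- The colours at the ends `0` and `1` determine the colouring of the two strands, so at most one
summand survives. -/
theorem sum_glue_parallel (T : Tangle 4 A N X) (c : A → Color) :
    (∑ c' : Fin 2 → Color, if ∀ i, c (T.bd i) = c' (parallel.bd i) then
      T.weight c * parallel.weight c' else 0) =
      (if c (T.bd 0) = c (T.bd 3) ∧ c (T.bd 1) = c (T.bd 2) then 1 else 0) * T.weight c := by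
  rw [Finset.sum_eq_single ![c (T.bd 0), c (T.bd 1)]]
  · simp [weight_of_isEmpty, Fin.forall_fin_succ, parallel, and_comm,
      eq_comm (a := c (T.bd 2)), eq_comm (a := c (T.bd 3))]
  · intro c' _ hc'
    refine if_neg fun h => hc' (funext fun i => ?_)
    have h0 := h 0
    have h1 := h 1
    fin_cases i
    · simpa [parallel] using h0.symm
    · simpa [parallel] using h1.symm
  · simp

theorem sum_glue_crossed (T : Tangle 4 A N X) (c : A → Color) :
    (∑ c' : Fin 4 → Color, if ∀ i, c (T.bd i) = c' (crossed.bd i) then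
      T.weight c * crossed.weight c' else 0) =
      (if c (T.bd 0) = c (T.bd 2) ∧ c (T.bd 1) = c (T.bd 3) then 1 else 0) * T.weight c := by
  rw [Finset.sum_eq_single fun i => c (T.bd i)]
  · rw [if_pos (by simp [Fin.forall_fin_succ, crossed])]
    simp [weight, crossed, crossingTensor, finprod_of_isEmpty, finprod_unique]
  · intro c' _ hc'
    refine if_neg fun h => hc' (funext fun i => ?_)
    have := (h i).symm
    fin_cases i <;> simpa [crossed] using this
  · simp

theorem bracket_eq_parallel_sub_crossed [Finite A] [Finite N] [Finite X] : D.bracket =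
    (Y.outside.glue parallel).bracket - (Y.outside.glue crossed).bracket := by
  classical
  have := Fintype.ofFinite A
  -- Summing first over the colour of the removed edge contracts the two node tensors, while the
  -- outside keeps its colours.
  have hs : ∀ c : {a : A // a ≠ Y.edge} → Color,
      ∑ x, D.weight ((Equiv.funSplitAt Y.edge Color).symm (x, c)) =
      ((if c (Y.outside.bd 0) = c (Y.outside.bd 3) ∧ c (Y.outside.bd 1) = c (Y.outside.bd 2)
          then 1 else 0) -
        (if c (Y.outside.bd 0) = c (Y.outside.bd 2) ∧ c (Y.outside.bd 1) = c (Y.outside.bd 3)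
          then 1 else 0)) * Y.outside.weight c := by
    intro c
    rw [← sum_nodeTensor_mul, Finset.sum_mul]
    refine Finset.sum_congr rfl fun x _ => ?_
    have hx : (Equiv.funSplitAt Y.edge Color).symm (x, c) Y.edge = x := by simp
    have hc : ∀ a : {a : A // a ≠ Y.edge},
        (Equiv.funSplitAt Y.edge Color).symm (x, c) a = c a := fun a => by simp [a.2]
    rw [Y.weight_eq, hx]
    simp only [hc]
  rw [bracket_eq_sum, bracket_glue, bracket_glue,
    ← (Equiv.funSplitAt Y.edge Color).symm.sum_comp, Fintype.sum_prod_type_right]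
  simp_rw [hs, sum_glue_parallel, sum_glue_crossed, sub_mul, Finset.sum_sub_distrib]

end Penrose

end Tangle

theorem mainTheorem1 :
    (∀ (α β : Type*) (G : Graph α β) [Finite V(G)] [Finite E(G)] (hG : IsCubicGraph G)
        (Γ : PlaneDrawing G) (hΓ : Γ.IsImmersion),
      (hΓ.diagram hG).bracket = (Nat.card {c : E(G) → Color // IsProperEdgeColoring G c} : ℂ)) ∧
    (∀ (A N X : Type*) [Finite A] [Finite N] [Finite X] (D : Diagram A N X) (Y : D.YForm),
      D.bracket =
        (Y.outside.glue Tangle.parallel).bracket - (Y.outside.glue Tangle.crossed).bracket) ∧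
    (∀ (A N X : Type*) [Finite A] [Finite N] [Finite X] (D : Diagram A N X),
      (Tangle.circle.glue D).bracket = 3 * D.bracket) ∧
    Tangle.circle.bracket = 3 ∧
    (∀ (A N X : Type*) [Finite A] [Finite N] [Finite X] (D : Diagram A N X) (x : X),
      D.kind x = .circled →
        D.bracket = 2 * (D.withKind x .dotted).bracket - (D.withKind x .plain).bracket) :=
  ⟨fun _ _ _ _ _ hG _ hΓ => hΓ.bracket_diagram hG,
    fun _ _ _ _ _ _ _ Y => Tangle.bracket_eq_parallel_sub_crossed Y,
    fun _ _ _ _ _ _ D => D.bracket_circle_glue, Tangle.bracket_circle,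
    fun _ _ _ _ _ _ D x h => D.bracket_of_kind_eq_circled x h⟩
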